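/- Let $d\ge 1$ and let $\mathcal C=\{\xi\in\mathbb R^d : r\le|\xi|\le R\}$ be a ring, $0<r<R$. There exists a constant $C>0$, depending only on $d$, $r$ and $R$, with the following property. Let $h$ be a real number and let $u_0,u_1\in L^1(\mathbb R^d;\mathbb C)$ be such that the supports of their Fourier transforms $\widehat u_j(\xi)=\int_{\mathbb R^d}e^{-2\pi i\,x\cdot\xi}u_j(x)\,dx$ satisfy \[ \operatorname{Supp}\widehat u_0\cup\operatorname{Supp}\widehat u_1\subset\mathcal C \quad\text{and}\quad \max\bigl\{\operatorname{diam}(\operatorname{Supp}\widehat u_0),\operatorname{diam}(\operatorname{Supp}\widehat u_1)\bigr\}\le h . \] Then the Cauchy problem \[ \partial_t^2u-\Delta u=0\ \text{ on }\mathbb R\times\mathbb R^d,\qquad u|_{t=0}=u_0,\quad \partial_tu|_{t=0}=u_1 \quad\text{(almost everywhere)} \] has exactly one solution $u\in C^2(\mathbb R\times\mathbb R^d;\mathbb C)$, and for every real number $\widetilde d\in[0,d-1]$ and every $t>0$, \[ \|u(t,\cdot)\|_{L^\infty}\le \frac{C\,h^{d-\widetilde d}}{t^{\widetilde d/2}}\bigl(\|u_0\|_{L^1}+\|u_1\|_{L^1}\bigr).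 \] -/

import Mathlib

open MeasureTheory
open scoped FourierTransform

namespace FreeWave

/-- The closed ring `{ξ ∈ ℝᵈ : r ≤ |ξ| ≤ R}`. -/
def annulus (d : ℕ) (r R : ℝ) : Set (EuclideanSpace ℝ (Fin d)) :=
  {ξ | r ≤ ‖ξ‖ ∧ ‖ξ‖ ≤ R}

/-- `u` is a (classical, global in time) solution of the Cauchy problem
`∂ₜ² u - Δ u = 0` on `ℝ × ℝᵈ`, `u(0, ·) = u₀`, `∂ₜ u(0, ·) = u₁`.
The data are elements of `L¹`, so the initial conditions are equalities almost everywhere. -/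
structure IsSolution {d : ℕ} (u₀ u₁ : EuclideanSpace ℝ (Fin d) → ℂ)
    (u : ℝ → EuclideanSpace ℝ (Fin d) → ℂ) : Prop where
  contDiff : ContDiff ℝ 2 (fun p : ℝ × EuclideanSpace ℝ (Fin d) => u p.1 p.2)
  wave_eq : ∀ (t : ℝ) (x : EuclideanSpace ℝ (Fin d)),
    iteratedDeriv 2 (fun s : ℝ => u s x) t - Laplacian.laplacian (u t) x = 0
  initial : u 0 =ᵐ[volume] u₀
  initial_deriv : (fun x => deriv (fun s : ℝ => u s x) 0) =ᵐ[volume] u₁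

end FreeWave

/-!
The solution is `u(t, x) = ∫ e^{2πi x·ξ} (cos(2πt|ξ|) û₀(ξ) + sin(2πt|ξ|)/(2π|ξ|) û₁(ξ)) dξ`, a sum
of four half-waves `∫ e^{2πi(x·ξ ± t|ξ|)} w(|ξ|²) û(ξ) dξ` (`halfWave`, `waveSolution`).

*Well-posedness.* Since `û₀` and `û₁` are continuous with compact support, `u` is smooth, and
Fourier inversion (`fourierInv_fourier_ae_eq`) gives the initial data almost everywhere. Nothing is assumed
about the growth of a competing `C²` solution, so uniqueness (`IsSolution.unique`) rests on finite
speed of propagation: for the real and imaginary parts of a difference of solutions, the energy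
weighted by `((A - t)² - |x|²)₊²` is nonincreasing for `t ≤ A`, and `A` is arbitrary
(`eq_zero_of_wave_of_nonneg`). Negative times follow by reflection.

*Decay.* Let `δ` be the diameter of the support of `û`. The bound `‖û‖_{L¹} ≲ δ^d ‖u‖_{L¹}` settles
the case where `δ√t` is bounded. Otherwise put `ε = t^{-1/2}`, which is then small and at most `δ`,
and cut the range of `a = |ξ|²`, an interval of length `O(δ)`, into pieces `|a - s| ≲ ε`. On one
piece, write `a = s + εy`. The phase `t√a` is affine in `a` up to the remainder
`-y²/(2√s(√s + √a)²)`, in which the large parameter `t` has disappeared. Hence, up to a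
unimodular factor, the half-wave restricted to the piece is
`∫ e^{2πi(x·ξ + τ|ξ|²)} g((|ξ|² - s)/ε) û(ξ) dξ` with `|τ| ~ t` and `g` in a compact
family of bumps (`remainderAmplitude`). Expanding `g` by Fourier inversion turns this into a
superposition of Schrödinger waves, each of which decays like `|τ + η/ε|^{-d/2}` by the explicit
Gaussian kernel (`norm_integral_fourierChar_quadratic_le`); the weights `ĝ(η)` decay rapidly,
uniformly in the family (`exists_uniform_weighted_fourier_bound`). So each piece is `O(t^{-d/2})`
(`exists_norm_shell_le`), and averaging over `s` costs a factor `δ/ε = δ√t`, which gives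
`δ t^{-(d-1)/2}`. As `δ√t ≥ 1`, this is at most `δ^{d-d'} t^{-d'/2}` for every `d' ≤ d - 1`
(`exists_norm_halfWave_le`).
-/

namespace FreeWave

/-! ### Fourier inversion almost everywhere and the Schrödinger kernel -/

section FourierL1

open Real Filter Topology
open scoped ContDiff RealInnerProductSpace

variable {V : Type*} [NormedAddCommGroup V] [InnerProductSpace ℝ V] [FiniteDimensional ℝ V]
  [MeasurableSpace V] [BorelSpace V]

theorem integral_fourier_mul_eq_integral_mul_fourier {f g : V → ℂ} (hf : Integrable f)
    (hg : Integrable g) : ∫ ξ, 𝓕 f ξ * g ξ = ∫ x, f x * 𝓕 g x := by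
  have h := VectorFourier.integral_fourierIntegral_smul_eq_flip (e := Real.fourierChar)
    (μ := (volume : Measure V)) (ν := (volume : Measure V)) (L := innerₗ V)
    Real.continuous_fourierChar (by simpa using! continuous_inner) hf hg
  simp only [smul_eq_mul, flip_innerₗ] at h
  exact h

theorem continuous_fourier_of_integrable {f : V → ℂ} (hf : Integrable f) : Continuous (𝓕 f) :=
  VectorFourier.fourierIntegral_continuous Real.continuous_fourierChar
    (by simpa using! continuous_inner) hf

theorem norm_fourier_le_integral_norm (f : V → ℂ) (ξ : V) : ‖𝓕 f ξ‖ ≤ ∫ x, ‖f x‖ :=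
  VectorFourier.norm_fourierIntegral_le_integral_norm _ _ _ _ _

/-- Fourier inversion for an integrable function with integrable transform, at almost every point:
both sides have the same integral against every test function, because a test function is the
transform of a Schwartz function. -/
theorem fourierInv_fourier_ae_eq {f : V → ℂ} (hf : Integrable f) (hf' : Integrable (𝓕 f)) :
    𝓕⁻ (𝓕 f) =ᵐ[volume] f := by
  have hc : Continuous (𝓕⁻ (𝓕 f)) := by
    rw [fourierInv_eq_fourier_comp_neg]
    exact continuous_fourier_of_integrable hf'.comp_neg
  refine ae_eq_of_integral_contDiff_smul_eq hc.locallyIntegrable hf.locallyIntegrable ?_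
  intro g hg hgs
  have hg1 : ContDiff ℝ ∞ (fun x => (g x : ℂ)) := Complex.ofRealCLM.contDiff.comp hg
  have hgs1 : HasCompactSupport (fun x => (g x : ℂ)) :=
    hgs.comp_left (g := fun y : ℝ => (y : ℂ)) (by simp)
  set G : SchwartzMap V ℂ := hgs1.toSchwartzMap hg1 with hG
  have hGc : ∀ x, G x = (g x : ℂ) := fun x => rfl
  have hGi : Integrable (G : V → ℂ) := G.integrable
  have hk : Integrable (𝓕⁻ (G : V → ℂ)) := by
    rw [← SchwartzMap.fourierInv_coe]; exact (𝓕⁻ G).integrable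
  have hk' : 𝓕 (𝓕⁻ (G : V → ℂ)) = G := by
    rw [← SchwartzMap.fourierInv_coe, ← SchwartzMap.fourier_coe,
      FourierTransform.fourier_fourierInv_eq]
  have h1 : ∫ x, f x * G x = ∫ ξ, 𝓕 f ξ * 𝓕⁻ (G : V → ℂ) ξ := by
    conv_lhs => rw [← hk']
    exact (integral_fourier_mul_eq_integral_mul_fourier hf hk).symm
  have h2 : ∫ x, 𝓕⁻ (𝓕 f) x * G x = ∫ ξ, 𝓕 f ξ * 𝓕⁻ (G : V → ℂ) ξ := by
    rw [fourierInv_eq_fourier_comp_neg,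
      integral_fourier_mul_eq_integral_mul_fourier hf'.comp_neg hGi,
      ← integral_neg_eq_self]
    simp [fourierInv_eq_fourier_neg]
  simp only [← hGc, Complex.real_smul, mul_comm (G _)]
  rw [h2, h1]

theorem norm_fourier_gaussian_le {b : ℂ} (hb : 0 < b.re) (hb' : b.im ≠ 0) (x w : V) :
    ‖𝓕 (fun v : V ↦ Complex.exp (-b * ‖v‖ ^ 2 + 2 * π * Complex.I * ⟪x, v⟫)) w‖ ≤
      (π / |b.im|) ^ (Module.finrank ℝ V / 2 : ℝ) := by
  rw [fourier_gaussian_innerProductSpace' hb, norm_mul]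
  have h1 : ‖(π / b : ℂ) ^ (Module.finrank ℝ V / 2 : ℂ)‖ ≤
      (π / |b.im|) ^ (Module.finrank ℝ V / 2 : ℝ) := by
    have : (Module.finrank ℝ V / 2 : ℂ) = ((Module.finrank ℝ V / 2 : ℝ) : ℂ) := by push_cast; rfl
    rw [this, Complex.norm_cpow_real, norm_div, Complex.norm_real, Real.norm_of_nonneg pi_pos.le]
    gcongr
    exact Complex.abs_im_le_norm b
  have h2 : ‖Complex.exp (-π ^ 2 * ‖x - w‖ ^ 2 / b)‖ ≤ 1 := by
    rw [Complex.norm_exp, Real.exp_le_one_iff]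
    have : (-π ^ 2 * ‖x - w‖ ^ 2 / b : ℂ) = ((-π ^ 2 * ‖x - w‖ ^ 2 : ℝ) : ℂ) * b⁻¹ := by
      push_cast; rw [div_eq_mul_inv]
    rw [this, Complex.re_ofReal_mul, Complex.inv_re]
    have : 0 ≤ b.re / Complex.normSq b := div_nonneg hb.le (Complex.normSq_nonneg _)
    have h3 : 0 ≤ π ^ 2 * ‖x - w‖ ^ 2 := by positivity
    nlinarith
  calc _ ≤ (π / |b.im|) ^ (Module.finrank ℝ V / 2 : ℝ) * 1 := by gcongr
    _ = _ := mul_one _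

/-- The dispersive estimate for the Schrödinger group: the oscillating Gaussian
`ξ ↦ e^{2πi(x·ξ + τ|ξ|²)}` has a bounded Fourier transform. The damping factor `e^{-δ|ξ|²}` makes
this meaningful, and `δ → 0`. -/
theorem norm_integral_fourierChar_quadratic_le {u : V → ℂ} (hu : Integrable u)
    (hu' : Integrable (𝓕 u)) (x : V) {τ : ℝ} (hτ : τ ≠ 0) :
    ‖∫ ξ, (𝐞 (⟪ξ, x⟫ + τ * ‖ξ‖ ^ 2) : ℂ) * 𝓕 u ξ‖ ≤
      (2 * |τ|)⁻¹ ^ (Module.finrank ℝ V / 2 : ℝ) * ∫ y, ‖u y‖ := by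
  set G : ℝ → V → ℂ := fun δ v =>
    Complex.exp (-(δ - 2 * π * τ * Complex.I) * ‖v‖ ^ 2 + 2 * π * Complex.I * ⟪x, v⟫) with hG
  have hnorm : ∀ δ v, ‖G δ v‖ = Real.exp (-δ * ‖v‖ ^ 2) := by
    intro δ v
    rw [hG, Complex.norm_exp]
    congr 1
    simp [← Complex.ofReal_pow]
  have hlim : Tendsto (fun δ : ℝ => ∫ ξ, G δ ξ * 𝓕 u ξ) (𝓝[>] 0)
      (𝓝 (∫ ξ, (𝐞 (⟪ξ, x⟫ + τ * ‖ξ‖ ^ 2) : ℂ) * 𝓕 u ξ)) := by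
    refine tendsto_integral_filter_of_dominated_convergence (fun ξ => ‖𝓕 u ξ‖) ?_ ?_ hu'.norm ?_
    · refine Eventually.of_forall fun δ => ?_
      refine AEStronglyMeasurable.mul (Continuous.aestronglyMeasurable ?_) hu'.1
      simp only [hG]
      fun_prop
    · filter_upwards [self_mem_nhdsWithin] with δ hδ
      refine Eventually.of_forall fun ξ => ?_
      rw [norm_mul, hnorm]
      have : Real.exp (-δ * ‖ξ‖ ^ 2) ≤ 1 := by
        rw [Real.exp_le_one_iff]
        have : 0 < δ := hδ
        nlinarith [sq_nonneg ‖ξ‖]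
      exact mul_le_of_le_one_left (norm_nonneg _) this
    · refine Eventually.of_forall fun ξ => ?_
      refine Tendsto.mul_const _ ?_
      have h0 : (𝐞 (⟪ξ, x⟫ + τ * ‖ξ‖ ^ 2) : ℂ) = G 0 ξ := by
        rw [Real.fourierChar_apply, hG]
        simp only [real_inner_comm x ξ]
        push_cast
        ring_nf
      rw [h0]
      have : Continuous fun δ : ℝ => G δ ξ := by simp only [hG]; fun_prop
      exact (this.tendsto 0).mono_left nhdsWithin_le_nhds
  refine le_of_tendsto hlim.norm ?_
  filter_upwards [self_mem_nhdsWithin] with δ hδ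
  have hδ : 0 < δ := hδ
  set b : ℂ := (δ - 2 * π * τ * Complex.I) with hbdef
  have hbre : b.re = δ := by simp [hbdef]
  have hbim : b.im = -(2 * π * τ) := by simp [hbdef]
  have hbre0 : 0 < b.re := by rw [hbre]; exact hδ
  have hbim0 : b.im ≠ 0 := by
    rw [hbim]; have := pi_pos; simp [hτ, this.ne']
  have hGi : Integrable (G δ) := by
    have := GaussianFourier.integrable_cexp_neg_mul_sq_norm_add hbre0 (2 * π * Complex.I) x
    exact this
  have hbd : π / |b.im| = (2 * |τ|)⁻¹ := by
    rw [hbim, abs_neg, abs_mul, abs_of_pos (by positivity : 0 < 2 * π)]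
    have := pi_pos.ne'
    have : |τ| ≠ 0 := by simpa using hτ
    field_simp
  have hswap : ∫ ξ, G δ ξ * 𝓕 u ξ = ∫ y, 𝓕 (G δ) y * u y := by
    rw [integral_fourier_mul_eq_integral_mul_fourier hGi hu]
  rw [hswap, ← integral_const_mul]
  refine norm_integral_le_of_norm_le (hu.norm.const_mul _) (Eventually.of_forall fun y => ?_)
  rw [norm_mul]
  gcongr
  rw [← hbd]
  exact norm_fourier_gaussian_le hbre0 hbim0 x y

end FourierL1

/-! ### Uniform weighted bounds for Fourier transforms of families of bumps -/

section Bumps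

open Real Filter Topology Set
open scoped ContDiff

theorem integrable_one_add_norm_rpow_neg_two :
    Integrable (fun η : ℝ => (1 + ‖η‖) ^ (-2 : ℝ)) :=
  integrable_one_add_norm (by simp)

theorem hasCompactSupport_of_eq_zero {E : Type*} [Zero E] {g : ℝ → E}
    (hg : ∀ y, 1 / 2 ≤ |y| → g y = 0) : HasCompactSupport g := by
  refine .intro (isCompact_Icc (a := (-1 : ℝ)) (b := 1)) fun y hy => hg y ?_
  by_contra h
  rw [not_le, abs_lt] at h
  exact hy ⟨by linarith, by linarith⟩

/-- Integration by parts; the constant `2` is the length of `[-1, 1]`, which contains the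
support. -/
theorem pow_mul_norm_fourier_le {g : ℝ → ℂ} (hg : ContDiff ℝ ∞ g)
    (hsupp : ∀ y, 1 / 2 ≤ |y| → g y = 0) {M : ℝ} {n : ℕ}
    (hM : ∀ y, ‖iteratedDeriv n g y‖ ≤ M) (η : ℝ) :
    |η| ^ n * ‖𝓕 g η‖ ≤ 2 * M := by
  have hcont : ∀ m : ℕ, Continuous (iteratedDeriv m g) := fun m =>
    hg.continuous_iteratedDeriv m (by exact_mod_cast le_top)
  have hzero : ∀ (m : ℕ) (y : ℝ), y ∉ Icc (-1 : ℝ) 1 → iteratedDeriv m g y = 0 := by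
    intro m y hy
    have hy' : 1 / 2 < |y| := by
      by_contra h
      rw [not_lt, abs_le] at h
      exact hy ⟨by linarith, by linarith⟩
    have : g =ᶠ[𝓝 y] fun _ => 0 := by
      filter_upwards [continuous_abs.continuousAt.eventually_const_lt hy'] with z hz
      exact hsupp z hz.le
    rw [this.iteratedDeriv_eq m, iteratedDeriv_const]
    simp
  have hint : ∀ m : ℕ, Integrable (iteratedDeriv m g) := fun m =>
    (hcont m).integrable_of_hasCompactSupport (.intro isCompact_Icc (hzero m))
  have hF := congrFun (Real.fourier_iteratedDeriv (f := g) (N := ⊤) (n := n) hg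
    (fun m _ => hint m) le_top) η
  have h1 : ‖𝓕 (iteratedDeriv n g) η‖ ≤ 2 * M := by
    refine (norm_fourier_le_integral_norm _ _).trans ?_
    rw [← setIntegral_eq_integral_of_forall_compl_eq_zero (s := Icc (-1 : ℝ) 1)
      (fun y hy => by rw [hzero n y hy, norm_zero])]
    have := norm_setIntegral_le_of_norm_le_const (μ := volume) (s := Icc (-1 : ℝ) 1)
      (f := fun y => ‖iteratedDeriv n g y‖) (C := M) (by simp) (fun y _ => by simpa using hM y)
    have h3 : volume.real (Icc (-1 : ℝ) 1) = 2 := by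
      rw [Measure.real, Real.volume_Icc]; norm_num
    rw [h3] at this
    linarith [le_abs_self (∫ y in Icc (-1 : ℝ) 1, ‖iteratedDeriv n g y‖), 
      Real.norm_eq_abs (∫ y in Icc (-1 : ℝ) 1, ‖iteratedDeriv n g y‖)]
  rw [hF, norm_smul, norm_pow] at h1
  refine le_trans ?_ h1
  gcongr
  have : ‖(2 * π * Complex.I * η : ℂ)‖ = 2 * π * |η| := by
    simp [abs_of_pos pi_pos]
  rw [this]
  nlinarith [abs_nonneg η, Real.two_le_pi]

/-- Weighted integrability of the Fourier transform of a bump, with a bound that depends on the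
bump only through its derivatives. -/
theorem integral_weighted_norm_fourier_le {g : ℝ → ℂ} (hg : ContDiff ℝ ∞ g)
    (hsupp : ∀ y, 1 / 2 ≤ |y| → g y = 0) {M : ℝ} (k : ℕ)
    (hM : ∀ n ≤ k + 2, ∀ y, ‖iteratedDeriv n g y‖ ≤ M) :
    Integrable (fun η => ‖𝓕 g η‖ * (1 + |η|) ^ k) ∧
      ∫ η, ‖𝓕 g η‖ * (1 + |η|) ^ k ≤
        2 ^ (k + 4) * M * ∫ η : ℝ, (1 + ‖η‖) ^ (-2 : ℝ) := by
  have hgi : Integrable g :=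
    hg.continuous.integrable_of_hasCompactSupport (hasCompactSupport_of_eq_zero hsupp)
  have hpt : ∀ η, ‖𝓕 g η‖ * (1 + |η|) ^ k ≤ 2 ^ (k + 4) * M * (1 + ‖η‖) ^ (-2 : ℝ) := by
    intro η
    have h0 := pow_mul_norm_fourier_le hg hsupp (hM 0 (by omega)) η
    have h1 := pow_mul_norm_fourier_le hg hsupp (hM (k + 2) le_rfl) η
    rw [pow_zero, one_mul] at h0
    have hpos : 0 < 1 + |η| := by positivity
    have h2 : (1 + |η|) ^ (k + 2) ≤ 2 ^ (k + 2) * (1 + |η| ^ (k + 2)) := by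
      have hmax : 1 + |η| ≤ 2 * max 1 |η| := by
        linarith [le_max_left 1 |η|, le_max_right 1 |η|]
      calc (1 + |η|) ^ (k + 2) ≤ (2 * max 1 |η|) ^ (k + 2) := by gcongr
        _ = 2 ^ (k + 2) * max 1 |η| ^ (k + 2) := mul_pow _ _ _
        _ ≤ _ := by
          gcongr
          rcases le_total 1 |η| with h | h
          · rw [max_eq_right h]; linarith
          · rw [max_eq_left h, one_pow]; linarith [pow_nonneg (abs_nonneg η) (k + 2)]
    have h3 : ‖𝓕 g η‖ * (1 + |η|) ^ (k + 2) ≤ 2 ^ (k + 4) * M := by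
      calc ‖𝓕 g η‖ * (1 + |η|) ^ (k + 2) ≤ ‖𝓕 g η‖ * (2 ^ (k + 2) * (1 + |η| ^ (k + 2))) := by
            gcongr
        _ = 2 ^ (k + 2) * (‖𝓕 g η‖ + |η| ^ (k + 2) * ‖𝓕 g η‖) := by ring
        _ ≤ 2 ^ (k + 2) * (2 * M + 2 * M) := by gcongr
        _ = _ := by ring
    rw [Real.norm_eq_abs, Real.rpow_neg hpos.le, Real.rpow_two, ← div_eq_mul_inv,
      le_div_iff₀ (by positivity)]
    calc _ = ‖𝓕 g η‖ * (1 + |η|) ^ (k + 2) := by ring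
      _ ≤ _ := h3
  have hint := (integrable_one_add_norm_rpow_neg_two).const_mul (2 ^ (k + 4) * M)
  have hmeas : AEStronglyMeasurable (fun η => ‖𝓕 g η‖ * (1 + |η|) ^ k) volume := by
    have := continuous_fourier_of_integrable hgi
    exact Continuous.aestronglyMeasurable (by fun_prop)
  have hI : Integrable (fun η => ‖𝓕 g η‖ * (1 + |η|) ^ k) := by
    refine hint.mono' hmeas (Eventually.of_forall fun η => ?_)
    rw [Real.norm_of_nonneg (by positivity)]
    exact hpt η
  refine ⟨hI, ?_⟩
  rw [← integral_const_mul]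
  exact integral_mono hI hint hpt

variable {P : Type*} [NormedAddCommGroup P] [NormedSpace ℝ P]

/-- Partial derivatives in the last variable of a jointly smooth function are jointly smooth. -/
theorem exists_contDiffOn_iteratedDeriv_eq {Ω : Set (P × ℝ)} (hΩ : IsOpen Ω) {G : P × ℝ → ℂ}
    (hG : ContDiffOn ℝ ∞ G Ω) (n : ℕ) :
    ∃ H : P × ℝ → ℂ, ContDiffOn ℝ ∞ H Ω ∧
      ∀ p y, (p, y) ∈ Ω → iteratedDeriv n (fun y' => G (p, y')) y = H (p, y) := by
  induction n with
  | zero => exact ⟨G, hG, fun p y _ => by simp⟩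
  | succ n ih =>
    obtain ⟨H, hH, hHe⟩ := ih
    refine ⟨fun z => fderiv ℝ H z (0, 1), ?_, ?_⟩
    · have := hH.fderiv_of_isOpen (m := ∞) hΩ (by simp)
      exact this.clm_apply contDiffOn_const
    · intro p y hpy
      rw [iteratedDeriv_succ]
      have hnhds : ∀ᶠ y' in 𝓝 y, (p, y') ∈ Ω :=
        (Continuous.prodMk_right p).continuousAt.eventually_mem (hΩ.mem_nhds hpy)
      have heq : iteratedDeriv n (fun y' => G (p, y')) =ᶠ[𝓝 y] fun y' => H (p, y') := by
        filter_upwards [hnhds] with y' hy'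
        exact hHe p y' hy'
      rw [heq.deriv_eq]
      have hd : HasFDerivAt H (fderiv ℝ H (p, y)) (p, y) :=
        ((hH.contDiffAt (hΩ.mem_nhds hpy)).differentiableAt (by simp)).hasFDerivAt
      have hl : HasDerivAt (fun y' : ℝ => (p, y')) ((0 : P), (1 : ℝ)) y :=
        (hasDerivAt_const y p).prodMk (hasDerivAt_id y)
      exact (hd.comp_hasDerivAt y hl).deriv

/-- A jointly smooth family of bumps over a compact parameter set has uniformly bounded weighted
Fourier transforms. -/
theorem exists_uniform_weighted_fourier_bound {Ω : Set (P × ℝ)} (hΩ : IsOpen Ω) {G : P × ℝ → ℂ}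
    (hG : ContDiffOn ℝ ∞ G Ω) {K : Set P} (hK : IsCompact K) (hKΩ : K ×ˢ Icc (-1 : ℝ) 1 ⊆ Ω)
    (hsupp : ∀ p ∈ K, ∀ y, 1 / 2 ≤ |y| → G (p, y) = 0) (k : ℕ) :
    ∃ C : ℝ, ∀ p ∈ K, ContDiff ℝ ∞ (fun y => G (p, y)) ∧
      Integrable (fun η => ‖𝓕 (fun y => G (p, y)) η‖ * (1 + |η|) ^ k) ∧
      ∫ η, ‖𝓕 (fun y => G (p, y)) η‖ * (1 + |η|) ^ k ≤ C := by
  have hvanish : ∀ p ∈ K, ∀ y, 1 / 2 < |y| → (fun y' => G (p, y')) =ᶠ[𝓝 y] fun _ => 0 := by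
    intro p hp y hy
    filter_upwards [continuous_abs.continuousAt.eventually_const_lt hy] with y' hy'
    exact hsupp p hp y' hy'.le
  have hsmooth : ∀ p ∈ K, ContDiff ℝ ∞ (fun y => G (p, y)) := by
    intro p hp
    rw [contDiff_iff_contDiffAt]
    intro y
    rcases lt_or_ge (1 / 2) |y| with hy | hy
    · exact contDiffAt_const.congr_of_eventuallyEq (hvanish p hp y hy)
    · have hmem : (p, y) ∈ Ω := hKΩ ⟨hp, abs_le.1 (by linarith)⟩
      exact (hG.contDiffAt (hΩ.mem_nhds hmem)).comp y (contDiffAt_const.prodMk contDiffAt_id)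
  have hbound : ∀ n : ℕ, ∃ M : ℝ, ∀ p ∈ K, ∀ y, ‖iteratedDeriv n (fun y' => G (p, y')) y‖ ≤ M := by
    intro n
    obtain ⟨H, hH, hHe⟩ := exists_contDiffOn_iteratedDeriv_eq hΩ hG n
    obtain ⟨M, hM⟩ := (hK.prod isCompact_Icc).exists_bound_of_continuousOn
      (hH.continuousOn.mono hKΩ)
    refine ⟨max M 0, fun p hp y => ?_⟩
    rcases lt_or_ge (1 / 2) |y| with hy | hy
    · rw [(hvanish p hp y hy).iteratedDeriv_eq n, iteratedDeriv_const]
      simp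
    · have hmem : (p, y) ∈ K ×ˢ Icc (-1 : ℝ) 1 := ⟨hp, abs_le.1 (by linarith)⟩
      rw [hHe p y (hKΩ hmem)]
      exact (hM _ hmem).trans (le_max_left _ _)
  choose M hM using hbound
  set M' : ℝ := ∑ n ∈ Finset.range (k + 3), |M n| with hM'
  refine ⟨2 ^ (k + 4) * M' * ∫ η : ℝ, (1 + ‖η‖) ^ (-2 : ℝ), fun p hp => ⟨hsmooth p hp, ?_⟩⟩
  refine integral_weighted_norm_fourier_le (hsmooth p hp) (hsupp p hp) k fun n hn y => ?_
  refine ((hM n p hp y).trans (le_abs_self _)).trans ?_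
  exact Finset.single_le_sum (f := fun n => |M n|) (fun i _ => abs_nonneg _)
    (Finset.mem_range.2 (by omega))

end Bumps

/-! ### Superposition of Schrödinger waves -/

section Superposition

open Real Filter Topology Set
open scoped ContDiff RealInnerProductSpace

variable {V : Type*} [NormedAddCommGroup V] [InnerProductSpace ℝ V] [FiniteDimensional ℝ V]
  [MeasurableSpace V] [BorelSpace V]

theorem norm_fourierChar (x : ℝ) : ‖(𝐞 x : ℂ)‖ = 1 := Circle.norm_coe _

theorem coe_fourierChar_add (x y : ℝ) : (𝐞 (x + y) : ℂ) = 𝐞 x * 𝐞 y := by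
  rw [AddChar.map_add_eq_mul, Circle.coe_mul]

theorem continuous_coe_fourierChar : Continuous fun x : ℝ => (𝐞 x : ℂ) :=
  continuous_subtype_val.comp Real.continuous_fourierChar

/-- Expanding a radial amplitude `g((|ξ|² - s)/ε)` by Fourier inversion writes its wave as a
superposition of Schrödinger waves at the times `τ + η/ε`. -/
theorem norm_integral_mul_radial_amplitude_le {v : V → ℂ} (hv : Integrable v) (x : V)
    {τ s ε B : ℝ} {k : ℕ} {g : ℝ → ℂ} (hg : Continuous g) (hgi : Integrable g)
    (hgw : Integrable (fun η => ‖𝓕 g η‖ * (1 + |η|) ^ k))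
    (hB : ∀ η : ℝ, ‖∫ ξ, (𝐞 (⟪ξ, x⟫ + (τ + η / ε) * ‖ξ‖ ^ 2) : ℂ) * v ξ‖ ≤
      B * (1 + |η|) ^ k) :
    ‖∫ ξ, (𝐞 (⟪ξ, x⟫ + τ * ‖ξ‖ ^ 2) : ℂ) * g ((‖ξ‖ ^ 2 - s) / ε) * v ξ‖ ≤
      B * ∫ η, ‖𝓕 g η‖ * (1 + |η|) ^ k := by
  have hFc : Continuous (𝓕 g) := continuous_fourier_of_integrable hgi
  have hFi : Integrable (𝓕 g) := by
    refine hgw.mono' hFc.aestronglyMeasurable (Eventually.of_forall fun η => ?_)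
    have : 1 ≤ (1 + |η|) ^ k := one_le_pow₀ (by linarith [abs_nonneg η])
    exact le_mul_of_one_le_right (norm_nonneg _) this
  have hinv : ∀ y, g y = ∫ η, (𝐞 (η * y) : ℂ) * 𝓕 g η := by
    intro y
    conv_lhs => rw [← hg.fourierInv_fourier_eq hgi hFi]
    rw [Real.fourierInv_eq]
    refine integral_congr_ae (Eventually.of_forall fun η => ?_)
    simp [Circle.smul_def, mul_comm]
  have hphase : ∀ (ξ : V) (η : ℝ), (𝐞 (⟪ξ, x⟫ + τ * ‖ξ‖ ^ 2) : ℂ) *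
      (𝐞 (η * ((‖ξ‖ ^ 2 - s) / ε)) * 𝓕 g η) * v ξ =
      (𝐞 (-(η * s / ε)) * 𝓕 g η) * (𝐞 (⟪ξ, x⟫ + (τ + η / ε) * ‖ξ‖ ^ 2) * v ξ) := by
    intro ξ η
    have : (𝐞 (⟪ξ, x⟫ + τ * ‖ξ‖ ^ 2) : ℂ) * 𝐞 (η * ((‖ξ‖ ^ 2 - s) / ε)) =
        𝐞 (-(η * s / ε)) * 𝐞 (⟪ξ, x⟫ + (τ + η / ε) * ‖ξ‖ ^ 2) := by
      rw [← coe_fourierChar_add, ← coe_fourierChar_add]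
      congr 2
      ring
    linear_combination (𝓕 g η * v ξ) * this
  have hprod : Integrable (Function.uncurry fun (ξ : V) (η : ℝ) =>
      (𝐞 (⟪ξ, x⟫ + τ * ‖ξ‖ ^ 2) : ℂ) * (𝐞 (η * ((‖ξ‖ ^ 2 - s) / ε)) * 𝓕 g η) * v ξ)
      (volume.prod volume) := by
    have h1 : Integrable (fun z : V × ℝ => v z.1 * 𝓕 g z.2) (volume.prod volume) := hv.mul_prod hFi
    have h2 : Continuous fun z : V × ℝ => (𝐞 (⟪z.1, x⟫ + τ * ‖z.1‖ ^ 2) : ℂ) *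
        𝐞 (z.2 * ((‖z.1‖ ^ 2 - s) / ε)) := by
      refine (continuous_coe_fourierChar.comp ?_).mul (continuous_coe_fourierChar.comp ?_)
      · fun_prop
      · simp only [div_eq_mul_inv]; fun_prop
    have h3 := h1.bdd_mul (c := 1) h2.aestronglyMeasurable
      (Eventually.of_forall fun z => by simp [norm_fourierChar])
    refine h3.congr (Eventually.of_forall fun z => ?_)
    simp only [Function.uncurry]
    ring
  have hswap : ∫ ξ, (𝐞 (⟪ξ, x⟫ + τ * ‖ξ‖ ^ 2) : ℂ) * g ((‖ξ‖ ^ 2 - s) / ε) * v ξ =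
      ∫ η, (𝐞 (-(η * s / ε)) * 𝓕 g η) *
        ∫ ξ, (𝐞 (⟪ξ, x⟫ + (τ + η / ε) * ‖ξ‖ ^ 2) : ℂ) * v ξ := by
    calc _ = ∫ ξ, ∫ η, (𝐞 (⟪ξ, x⟫ + τ * ‖ξ‖ ^ 2) : ℂ) *
          (𝐞 (η * ((‖ξ‖ ^ 2 - s) / ε)) * 𝓕 g η) * v ξ := by
          refine integral_congr_ae (Eventually.of_forall fun ξ => ?_)
          simp only
          rw [hinv, ← integral_const_mul, ← integral_mul_const]
      _ = ∫ η, ∫ ξ, (𝐞 (⟪ξ, x⟫ + τ * ‖ξ‖ ^ 2) : ℂ) *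
          (𝐞 (η * ((‖ξ‖ ^ 2 - s) / ε)) * 𝓕 g η) * v ξ := integral_integral_swap hprod
      _ = _ := by
          refine integral_congr_ae (Eventually.of_forall fun η => ?_)
          simp only [hphase]
          rw [integral_const_mul]
  rw [hswap, ← integral_const_mul]
  refine norm_integral_le_of_norm_le (hgw.const_mul B) (Eventually.of_forall fun η => ?_)
  rw [norm_mul, norm_mul, norm_fourierChar, one_mul]
  calc _ ≤ ‖𝓕 g η‖ * (B * (1 + |η|) ^ k) := by gcongr; exact hB η
    _ = _ := by ring

end Superposition

/-! ### Comparison of the wave and Schrödinger phases -/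

section Dispersive

open Real Filter Topology Set
open scoped ContDiff RealInnerProductSpace

/-- In the variable `a = |ξ|² = s + εy`, with `ε = t^{-1/2}`, the wave phase `σt√a` differs from its
first-order Taylor polynomial at `s` by `-σy²/(2√s(√s + √a)²)`, a quantity independent of `t` up to
the bounded parameter `ε`. The amplitude collects this remainder, the multiplier `w` and the
cutoff `χ`. -/
noncomputable def remainderAmplitude (σ : ℝ) (w : ℝ → ℂ) (χ : ℝ → ℝ) (z : (ℝ × ℝ) × ℝ) : ℂ :=
  (𝐞 (-(σ * z.2 ^ 2 / (2 * √z.1.2 * (√z.1.2 + √(z.1.2 + z.1.1 * z.2)) ^ 2))) : ℂ) *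
    w (z.1.2 + z.1.1 * z.2) * χ z.2

theorem contDiff_coe_fourierChar : ContDiff ℝ ∞ fun x : ℝ => (𝐞 x : ℂ) := by
  have : (fun x : ℝ => (𝐞 x : ℂ)) = fun x : ℝ => Complex.exp ((2 * π * x : ℝ) * Complex.I) := by
    ext x; rw [Real.fourierChar_apply]
  rw [this]
  have h1 : ContDiff ℝ ∞ fun x : ℝ => ((2 * π * x : ℝ) : ℂ) :=
    Complex.ofRealCLM.contDiff.comp (contDiff_const.mul contDiff_id)
  exact (h1.mul contDiff_const).cexp

theorem contDiffOn_remainderAmplitude (σ : ℝ) {w : ℝ → ℂ} (hw : ContDiffOn ℝ ∞ w (Ioi 0))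
    {χ : ℝ → ℝ} (hχ : ContDiff ℝ ∞ χ) :
    ContDiffOn ℝ ∞ (remainderAmplitude σ w χ)
      {z : (ℝ × ℝ) × ℝ | 0 < z.1.2 ∧ 0 < z.1.2 + z.1.1 * z.2} := by
  set Ω : Set ((ℝ × ℝ) × ℝ) := {z | 0 < z.1.2 ∧ 0 < z.1.2 + z.1.1 * z.2}
  have h1 : ContDiff ℝ ∞ fun z : (ℝ × ℝ) × ℝ => z.1.2 := by fun_prop
  have h2 : ContDiff ℝ ∞ fun z : (ℝ × ℝ) × ℝ => z.1.2 + z.1.1 * z.2 := by fun_prop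
  have h3 : ContDiffOn ℝ ∞ (fun z : (ℝ × ℝ) × ℝ => √z.1.2) Ω :=
    h1.contDiffOn.sqrt fun z hz => hz.1.ne'
  have h4 : ContDiffOn ℝ ∞ (fun z : (ℝ × ℝ) × ℝ => √(z.1.2 + z.1.1 * z.2)) Ω :=
    h2.contDiffOn.sqrt fun z hz => hz.2.ne'
  have h5 : ContDiffOn ℝ ∞ (fun z : (ℝ × ℝ) × ℝ =>
      -(σ * z.2 ^ 2 / (2 * √z.1.2 * (√z.1.2 + √(z.1.2 + z.1.1 * z.2)) ^ 2))) Ω := by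
    refine (ContDiffOn.div ?_ ?_ ?_).neg
    · exact ContDiff.contDiffOn (by fun_prop)
    · exact (contDiffOn_const.mul h3).mul ((h3.add h4).pow 2)
    · intro z hz
      have := Real.sqrt_pos.2 hz.1
      have := Real.sqrt_nonneg (z.1.2 + z.1.1 * z.2)
      positivity
  have h6 : ContDiffOn ℝ ∞ (fun z : (ℝ × ℝ) × ℝ => w (z.1.2 + z.1.1 * z.2)) Ω :=
    hw.comp h2.contDiffOn fun z hz => hz.2
  have h7 : ContDiff ℝ ∞ fun z : (ℝ × ℝ) × ℝ => (χ z.2 : ℂ) :=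
    Complex.ofRealCLM.contDiff.comp (hχ.comp contDiff_snd)
  exact ((contDiff_coe_fourierChar.comp_contDiffOn h5).mul h6).mul h7.contDiffOn

theorem isOpen_remainderAmplitude_domain :
    IsOpen {z : (ℝ × ℝ) × ℝ | 0 < z.1.2 ∧ 0 < z.1.2 + z.1.1 * z.2} :=
  IsOpen.and (isOpen_lt (by fun_prop) (by fun_prop)) (isOpen_lt (by fun_prop) (by fun_prop))

/-- The Taylor expansion behind `remainderAmplitude`. -/
theorem fourierChar_sqrt_mul_eq_remainderAmplitude (σ : ℝ) (w : ℝ → ℂ) (χ : ℝ → ℝ)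
    {ε s a : ℝ} (hε : 0 < ε) (hs : 0 < s) (ha : 0 < a) :
    (𝐞 (σ * (ε ^ 2)⁻¹ * √a) : ℂ) * w a * χ ((a - s) / ε) =
      𝐞 (σ * (ε ^ 2)⁻¹ * √s / 2) * (𝐞 (σ * (ε ^ 2)⁻¹ / (2 * √s) * a) *
        remainderAmplitude σ w χ ((ε, s), (a - s) / ε)) := by
  have h1 : s + ε * ((a - s) / ε) = a := by field_simp; ring
  unfold remainderAmplitude
  simp only [h1]
  rw [← mul_assoc, ← mul_assoc, ← mul_assoc, ← coe_fourierChar_add,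
    ← coe_fourierChar_add]
  congr 4
  have hps := Real.sqrt_pos.2 hs
  have hpa := Real.sqrt_pos.2 ha
  have e1 : s = √s ^ 2 := (Real.sq_sqrt hs.le).symm
  have e2 : a = √a ^ 2 := (Real.sq_sqrt ha.le).symm
  have e3 : (a - s) = (√a - √s) * (√s + √a) := by rw [e1, e2]; simp; ring
  rw [e3]
  have e4 : σ * (ε ^ 2)⁻¹ / (2 * √s) * a = σ * (ε ^ 2)⁻¹ / (2 * √s) * √a ^ 2 := by rw [← e2]
  rw [e4]
  field_simp
  ring

/-- A smooth cutoff of integral one. -/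
theorem exists_cutoff : ∃ χ : ℝ → ℝ, ContDiff ℝ ∞ χ ∧ (∀ y, 1 / 2 ≤ |y| → χ y = 0) ∧
    ∫ y, χ y = 1 := by
  let φ : ContDiffBump (0 : ℝ) := ⟨1 / 4, 1 / 2, by norm_num, by norm_num⟩
  refine ⟨φ.normed volume, φ.contDiff_normed, fun y hy => ?_, φ.integral_normed⟩
  have : y ∉ Function.support (φ.normed volume) := by
    rw [φ.support_normed_eq]
    simpa [φ] using hy
  simpa using this

/-- At frequencies `τ + η/ε` with `|τ| ≳ ε⁻²`, the Schrödinger wave is bounded by `ε^d`, up to a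
polynomial loss in `η`: by dispersion if `|η| ≲ ε⁻¹` and trivially otherwise. -/
theorem norm_schrodinger_wave_le {d : ℕ} {u : EuclideanSpace ℝ (Fin d) → ℂ}
    (hu : Integrable u) (hu' : Integrable (𝓕 u)) (x : EuclideanSpace ℝ (Fin d))
    {A c ε τ : ℝ} (hA : ∫ ξ, ‖𝓕 u ξ‖ ≤ A * ∫ y, ‖u y‖) (hA0 : 0 ≤ A) (hc : 0 < c) (hε : 0 < ε)
    (hτ : c * (ε ^ 2)⁻¹ ≤ |τ|) (η : ℝ) :
    ‖∫ ξ, (𝐞 (⟪ξ, x⟫ + (τ + η / ε) * ‖ξ‖ ^ 2) : ℂ) * 𝓕 u ξ‖ ≤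
      ((c⁻¹ ^ (d / 2 : ℝ) + A * (2 / c) ^ d) * ε ^ d * ∫ y, ‖u y‖) * (1 + |η|) ^ d := by
  have hu0 : 0 ≤ ∫ y, ‖u y‖ := integral_nonneg fun _ => norm_nonneg _
  have hη1 : 1 ≤ (1 + |η|) ^ d := one_le_pow₀ (by linarith [abs_nonneg η])
  have hcp : 0 ≤ c⁻¹ ^ (d / 2 : ℝ) := by positivity
  have hcA : 0 ≤ A * (2 / c) ^ d := by positivity
  rcases le_or_gt (ε * |η|) (c / 2) with h | h
  · have hlow : c / 2 * (ε ^ 2)⁻¹ ≤ |τ + η / ε| := by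
      have h1 : |η / ε| ≤ c / 2 * (ε ^ 2)⁻¹ := by
        rw [abs_div, abs_of_pos hε, div_le_iff₀ hε]
        have : c / 2 * (ε ^ 2)⁻¹ * ε = c / 2 / ε := by field_simp
        rw [this, le_div_iff₀ hε]
        linarith
      have h2 : |τ| ≤ |τ + η / ε| + |η / ε| := by
        simpa using abs_sub (τ + η / ε) (η / ε)
      linarith
    have hpos : 0 < c / 2 * (ε ^ 2)⁻¹ := by positivity
    have hne : τ + η / ε ≠ 0 := by
      intro h0
      rw [h0, abs_zero] at hlow
      linarith
    have h3 := norm_integral_fourierChar_quadratic_le hu hu' x hne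
    rw [finrank_euclideanSpace_fin] at h3
    have h4 : (2 * |τ + η / ε|)⁻¹ ^ (d / 2 : ℝ) ≤ c⁻¹ ^ (d / 2 : ℝ) * ε ^ d := by
      have h5 : (2 * |τ + η / ε|)⁻¹ ≤ c⁻¹ * ε ^ 2 := by
        have : c⁻¹ * ε ^ 2 = (2 * (c / 2 * (ε ^ 2)⁻¹))⁻¹ := by field_simp
        rw [this]
        gcongr
      calc _ ≤ (c⁻¹ * ε ^ 2) ^ (d / 2 : ℝ) := by gcongr
        _ = _ := by
          rw [Real.mul_rpow (by positivity) (by positivity), ← Real.rpow_natCast ε 2,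
            ← Real.rpow_mul hε.le, ← Real.rpow_natCast ε d]
          congr 2
          push_cast
          ring
    calc _ ≤ (c⁻¹ ^ (d / 2 : ℝ) * ε ^ d) * ∫ y, ‖u y‖ := h3.trans (by gcongr)
      _ ≤ ((c⁻¹ ^ (d / 2 : ℝ) + A * (2 / c) ^ d) * ε ^ d * ∫ y, ‖u y‖) := by
          gcongr
          linarith
      _ ≤ _ := le_mul_of_one_le_right (by positivity) hη1
  · have h1 : 1 ≤ (2 / c) ^ d * ε ^ d * (1 + |η|) ^ d := by
      rw [← mul_pow, ← mul_pow]
      refine one_le_pow₀ ?_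
      have : 1 < 2 / c * ε * |η| := by
        have : 2 / c * ε * |η| = ε * |η| / (c / 2) := by field_simp
        rw [this, one_lt_div (by positivity)]
        exact h
      have : 0 < 2 / c * ε := by positivity
      nlinarith
    have h2 : ‖∫ ξ, (𝐞 (⟪ξ, x⟫ + (τ + η / ε) * ‖ξ‖ ^ 2) : ℂ) * 𝓕 u ξ‖ ≤ A * ∫ y, ‖u y‖ := by
      refine (norm_integral_le_of_norm_le hu'.norm (Eventually.of_forall fun ξ => ?_)).trans hA
      rw [norm_mul, norm_fourierChar, one_mul]
    calc _ ≤ A * ∫ y, ‖u y‖ := h2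
      _ ≤ (A * ∫ y, ‖u y‖) * ((2 / c) ^ d * ε ^ d * (1 + |η|) ^ d) :=
          le_mul_of_one_le_right (by positivity) h1
      _ = (A * (2 / c) ^ d) * ε ^ d * (∫ y, ‖u y‖) * (1 + |η|) ^ d := by ring
      _ ≤ _ := by
          gcongr
          linarith

end Dispersive

/-! ### The dispersive estimate for half-waves -/

section DispersiveEstimate

open Real Filter Topology Set
open scoped ContDiff RealInnerProductSpace

variable {d : ℕ} {r R : ℝ} {u : EuclideanSpace ℝ (Fin d) → ℂ}

theorem annulus_subset_closedBall : annulus d r R ⊆ Metric.closedBall 0 R := fun ξ hξ => by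
  simpa using hξ.2

theorem hasCompactSupport_of_tsupport_subset_annulus {f : EuclideanSpace ℝ (Fin d) → ℂ}
    (hf : tsupport f ⊆ annulus d r R) : HasCompactSupport f :=
  (isCompact_closedBall _ _).of_isClosed_subset (isClosed_tsupport _)
    (hf.trans annulus_subset_closedBall)

theorem integrable_fourier_of_tsupport_subset_annulus (hu : Integrable u)
    (hs : tsupport (𝓕 u) ⊆ annulus d r R) : Integrable (𝓕 u) :=
  (continuous_fourier_of_integrable hu).integrable_of_hasCompactSupport
    (hasCompactSupport_of_tsupport_subset_annulus hs)

theorem integral_norm_fourier_le_of_tsupport_subset {s : Set (EuclideanSpace ℝ (Fin d))}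
    (hs : tsupport (𝓕 u) ⊆ s) (hfin : volume s < ⊤) :
    ∫ ξ, ‖𝓕 u ξ‖ ≤ volume.real s * ∫ y, ‖u y‖ := by
  rw [← setIntegral_eq_integral_of_forall_compl_eq_zero (s := s)
    (fun ξ hξ => by rw [image_eq_zero_of_notMem_tsupport fun h => hξ (hs h), norm_zero])]
  have := norm_setIntegral_le_of_norm_le_const (μ := volume) (s := s)
      (f := fun ξ => ‖𝓕 u ξ‖) (C := ∫ y, ‖u y‖) hfin
      (fun ξ _ => by simpa using norm_fourier_le_integral_norm u ξ)
  rw [mul_comm]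
  exact (le_abs_self _).trans this

/-- The wave with Fourier multiplier `e^{2πiσt|ξ|} w(|ξ|²)` and initial profile `u`. -/
noncomputable def halfWave (σ : ℝ) (w : ℝ → ℂ) (u : EuclideanSpace ℝ (Fin d) → ℂ) (t : ℝ)
    (x : EuclideanSpace ℝ (Fin d)) : ℂ :=
  ∫ ξ, (𝐞 (⟪ξ, x⟫ + σ * t * ‖ξ‖) : ℂ) * (w (‖ξ‖ ^ 2) * 𝓕 u ξ)

/-- At time `ε⁻²`, the part of a half-wave with `|ξ|²` in an interval of length `ε` obeys the
Schrödinger decay `ε^d`. -/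
theorem exists_norm_shell_le (hr : 0 < r) {σ : ℝ} (hσ : |σ| = 1) {w : ℝ → ℂ}
    (hw : ContDiffOn ℝ ∞ w (Ioi 0)) {χ : ℝ → ℝ} (hχ : ContDiff ℝ ∞ χ)
    (hχ0 : ∀ y, 1 / 2 ≤ |y| → χ y = 0) :
    ∃ C : ℝ, 0 ≤ C ∧ ∀ u : EuclideanSpace ℝ (Fin d) → ℂ, Integrable u →
      tsupport (𝓕 u) ⊆ annulus d r R → ∀ x : EuclideanSpace ℝ (Fin d), ∀ ε s : ℝ, 0 < ε →
      ε ≤ r ^ 2 / 4 → s ∈ Icc (r ^ 2 / 2) (R ^ 2 + r ^ 2) →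
      ‖∫ ξ, (𝐞 (⟪ξ, x⟫ + σ * (ε ^ 2)⁻¹ * ‖ξ‖) : ℂ) * (w (‖ξ‖ ^ 2) * 𝓕 u ξ) *
        χ ((‖ξ‖ ^ 2 - s) / ε)‖ ≤ C * ε ^ d * ∫ y, ‖u y‖ := by
  obtain ⟨C, hC⟩ := exists_uniform_weighted_fourier_bound isOpen_remainderAmplitude_domain
    (contDiffOn_remainderAmplitude σ hw hχ)
    (K := Icc 0 (r ^ 2 / 4) ×ˢ Icc (r ^ 2 / 2) (R ^ 2 + r ^ 2))
    (isCompact_Icc.prod isCompact_Icc) (by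
      rintro ⟨⟨ε, s⟩, y⟩ ⟨⟨hε, hs⟩, hy⟩
      simp only [mem_Icc, mem_ofPred_eq] at hε hs hy ⊢
      have : 0 < r ^ 2 := by positivity
      refine ⟨by linarith, ?_⟩
      nlinarith)
    (fun p _ y hy => by simp [remainderAmplitude, hχ0 y hy]) d
  set c : ℝ := (2 * √(R ^ 2 + r ^ 2))⁻¹ with hcdef
  have hc : 0 < c := by
    have : 0 < √(R ^ 2 + r ^ 2) := Real.sqrt_pos.2 (by positivity)
    positivity
  set A : ℝ := volume.real (annulus d r R) with hAdef
  have hA0 : 0 ≤ A := measureReal_nonneg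
  set D : ℝ := c⁻¹ ^ (d / 2 : ℝ) + A * (2 / c) ^ d with hD
  have hD0 : 0 ≤ D := by positivity
  refine ⟨D * max C 0, mul_nonneg hD0 (le_max_right _ _), ?_⟩
  intro u hu hsupp x ε s hε hε' hs
  have hu0 : 0 ≤ ∫ y, ‖u y‖ := integral_nonneg fun _ => norm_nonneg _
  have hs0 : 0 < s := lt_of_lt_of_le (by positivity) hs.1
  have hu' := integrable_fourier_of_tsupport_subset_annulus hu hsupp
  have hA : ∫ ξ, ‖𝓕 u ξ‖ ≤ A * ∫ y, ‖u y‖ :=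
    integral_norm_fourier_le_of_tsupport_subset hsupp
      ((measure_mono annulus_subset_closedBall).trans_lt measure_closedBall_lt_top)
  obtain ⟨hgs, hgw, hgC⟩ := hC (ε, s) ⟨⟨hε.le, hε'⟩, hs⟩
  have hgi : Integrable (fun y => remainderAmplitude σ w χ ((ε, s), y)) := by
    refine hgs.continuous.integrable_of_hasCompactSupport
      (hasCompactSupport_of_eq_zero fun y hy => ?_)
    simp [remainderAmplitude, hχ0 y hy]
  have hτ : c * (ε ^ 2)⁻¹ ≤ |σ * (ε ^ 2)⁻¹ / (2 * √s)| := by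
    have hsq : 0 < √s := Real.sqrt_pos.2 hs0
    rw [abs_div, abs_mul, hσ, one_mul, abs_of_pos (by positivity : 0 < 2 * √s),
      abs_of_pos (by positivity : 0 < (ε ^ 2)⁻¹), div_eq_mul_inv, mul_comm]
    have hs2 := hs.2
    rw [hcdef]
    gcongr
  have key := norm_integral_mul_radial_amplitude_le (s := s) (ε := ε) hu' x hgs.continuous hgi hgw
    (norm_schrodinger_wave_le hu hu' x hA hA0 hc hε hτ)
  have heq : ∫ ξ, (𝐞 (⟪ξ, x⟫ + σ * (ε ^ 2)⁻¹ * ‖ξ‖) : ℂ) * (w (‖ξ‖ ^ 2) * 𝓕 u ξ) *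
        χ ((‖ξ‖ ^ 2 - s) / ε) = 𝐞 (σ * (ε ^ 2)⁻¹ * √s / 2) *
      ∫ ξ, (𝐞 (⟪ξ, x⟫ + σ * (ε ^ 2)⁻¹ / (2 * √s) * ‖ξ‖ ^ 2) : ℂ) *
        remainderAmplitude σ w χ ((ε, s), (‖ξ‖ ^ 2 - s) / ε) * 𝓕 u ξ := by
    rw [← integral_const_mul]
    refine integral_congr_ae (Eventually.of_forall fun ξ => ?_)
    simp only
    by_cases hξ : 𝓕 u ξ = 0
    · simp [hξ]
    · have hmem : ξ ∈ annulus d r R := hsupp (subset_tsupport _ hξ)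
      have ha : 0 < ‖ξ‖ ^ 2 := pow_pos (hr.trans_le hmem.1) 2
      have h := fourierChar_sqrt_mul_eq_remainderAmplitude σ w χ hε hs0 ha
      rw [Real.sqrt_sq (norm_nonneg _)] at h
      rw [coe_fourierChar_add, coe_fourierChar_add]
      linear_combination (𝐞 ⟪ξ, x⟫ * 𝓕 u ξ) * h
  rw [heq, norm_mul, norm_fourierChar, one_mul]
  refine key.trans ?_
  calc _ ≤ D * ε ^ d * (∫ y, ‖u y‖) * max C 0 := by
        gcongr
        exact hgC.trans (le_max_left _ _)
    _ = _ := by ring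

theorem integral_cutoff_eq {χ : ℝ → ℝ} (hχ0 : ∀ y, 1 / 2 ≤ |y| → χ y = 0)
    (hχ1 : ∫ y, χ y = 1) {ε a : ℝ} (hε : 0 < ε) {J : Set ℝ}
    (hJ : ∀ s, |a - s| < ε / 2 → s ∈ J) : ∫ s in J, χ ((a - s) / ε) = ε := by
  rw [setIntegral_eq_integral_of_forall_compl_eq_zero]
  · have h1 := integral_sub_left_eq_self (fun z => χ (z / ε)) (volume : Measure ℝ) a
    have h2 := Measure.integral_comp_div χ ε
    rw [h1, h2, hχ1, abs_of_pos hε, smul_eq_mul, mul_one]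
  · intro s hs
    refine hχ0 _ ?_
    by_contra h
    refine hs (hJ s ?_)
    rw [not_le, abs_div, abs_of_pos hε, div_lt_iff₀ hε] at h
    linarith

theorem exists_norm_multiplier_le (hr : 0 < r) {w : ℝ → ℂ} (hw : ContinuousOn w (Ioi 0)) :
    ∃ W : ℝ, 0 ≤ W ∧ ∀ ξ ∈ annulus d r R, ‖w (‖ξ‖ ^ 2)‖ ≤ W := by
  obtain ⟨W, hW⟩ := (isCompact_Icc (a := r ^ 2) (b := R ^ 2)).exists_bound_of_continuousOn
    (hw.mono fun a ha => lt_of_lt_of_le (by positivity : 0 < r ^ 2) ha.1)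
  refine ⟨max W 0, le_max_right _ _, fun ξ hξ => (hW _ ⟨?_, ?_⟩).trans (le_max_left _ _)⟩
  · exact pow_le_pow_left₀ hr.le hξ.1 2
  · exact pow_le_pow_left₀ (norm_nonneg _) hξ.2 2

theorem continuous_multiplier_mul_fourier (hr : 0 < r) {w : ℝ → ℂ}
    (hw : ContinuousOn w (Ioi 0)) (hu : Integrable u) (hsupp : tsupport (𝓕 u) ⊆ annulus d r R) :
    Continuous fun ξ => w (‖ξ‖ ^ 2) * 𝓕 u ξ := by
  rw [continuous_iff_continuousAt]
  intro ξ
  by_cases hξ : ξ ∈ tsupport (𝓕 u)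
  · have hpos : 0 < ‖ξ‖ ^ 2 := pow_pos (hr.trans_le (hsupp hξ).1) 2
    refine ContinuousAt.mul ?_ (continuous_fourier_of_integrable hu).continuousAt
    exact ContinuousAt.comp (f := fun ξ : EuclideanSpace ℝ (Fin d) => ‖ξ‖ ^ 2)
      (hw.continuousAt (Ioi_mem_nhds hpos)) (by fun_prop)
  · have : (fun ξ => w (‖ξ‖ ^ 2) * 𝓕 u ξ) =ᶠ[𝓝 ξ] fun _ => 0 := by
      filter_upwards [(isClosed_tsupport _).isOpen_compl.mem_nhds hξ] with ζ hζ
      rw [image_eq_zero_of_notMem_tsupport hζ, mul_zero]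
    exact continuousAt_const.congr this.symm

theorem integrable_multiplier_mul_fourier (hr : 0 < r) {w : ℝ → ℂ}
    (hw : ContinuousOn w (Ioi 0)) (hu : Integrable u) (hsupp : tsupport (𝓕 u) ⊆ annulus d r R) :
    Integrable fun ξ => w (‖ξ‖ ^ 2) * 𝓕 u ξ :=
  (continuous_multiplier_mul_fourier hr hw hu hsupp).integrable_of_hasCompactSupport
    ((hasCompactSupport_of_tsupport_subset_annulus hsupp).mul_left)

/-- For times `t = ε⁻²` with `ε` small and below the size `δ` of the frequency support, averaging
the shell bound over the positions `s` of the shells, an interval of length `O(δ)`, gives the decay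
`δ ε^{d-1}`. -/
theorem exists_mul_norm_halfWave_le (hr : 0 < r) {σ : ℝ} (hσ : |σ| = 1) {w : ℝ → ℂ}
    (hw : ContDiffOn ℝ ∞ w (Ioi 0)) :
    ∃ C : ℝ, 0 ≤ C ∧ ∀ u : EuclideanSpace ℝ (Fin d) → ℂ, Integrable u →
      tsupport (𝓕 u) ⊆ annulus d r R → ∀ x : EuclideanSpace ℝ (Fin d), ∀ ε : ℝ, 0 < ε →
      ε ≤ r ^ 2 / 4 → ε ≤ Metric.diam (tsupport (𝓕 u)) →
      ε * ‖halfWave σ w u (ε ^ 2)⁻¹ x‖ ≤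
        C * Metric.diam (tsupport (𝓕 u)) * ε ^ d * ∫ y, ‖u y‖ := by
  obtain ⟨χ, hχ, hχ0, hχ1⟩ := exists_cutoff
  obtain ⟨C, hC0, hC⟩ := exists_norm_shell_le (d := d) (R := R) hr hσ hw hχ hχ0
  refine ⟨C * (2 * (2 * |R| + 1)), by positivity, ?_⟩
  intro u hu hsupp x ε hε hε' hεδ
  set δ := Metric.diam (tsupport (𝓕 u)) with hδ
  have hu0 : 0 ≤ ∫ y, ‖u y‖ := integral_nonneg fun _ => norm_nonneg _
  obtain ⟨ξ₀, hξ₀⟩ : (tsupport (𝓕 u)).Nonempty := by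
    by_contra h
    rw [not_nonempty_iff_eq_empty] at h
    rw [hδ, h, Metric.diam_empty] at hεδ
    linarith
  have hbdd : Bornology.IsBounded (tsupport (𝓕 u)) :=
    (hasCompactSupport_of_tsupport_subset_annulus hsupp).isBounded
  -- the shells that meet the support: there `|ξ|²` is within `2|R|δ` of `|ξ₀|²`, and the cutoff
  -- adds at most `ε/2 ≤ δ`; the second interval keeps `s` away from `0`
  set J : Set ℝ := Icc (‖ξ₀‖ ^ 2 - (2 * |R| + 1) * δ) (‖ξ₀‖ ^ 2 + (2 * |R| + 1) * δ) ∩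
    Icc (r ^ 2 / 2) (R ^ 2 + r ^ 2) with hJ
  have hδ0 : 0 < δ := lt_of_lt_of_le hε hεδ
  have hJv : volume J ≤ ENNReal.ofReal (2 * (2 * |R| + 1) * δ) := by
    refine (measure_mono inter_subset_left).trans ?_
    rw [Real.volume_Icc]
    apply le_of_eq
    congr 1
    ring
  have hJfin : volume J < ⊤ := hJv.trans_lt ENNReal.ofReal_lt_top
  have hJv' : volume.real J ≤ 2 * (2 * |R| + 1) * δ :=
    ENNReal.toReal_le_of_le_ofReal (by positivity) hJv
  have hcut : ∀ ξ ∈ tsupport (𝓕 u), ∫ s in J, χ ((‖ξ‖ ^ 2 - s) / ε) = ε := by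
    intro ξ hξ
    refine integral_cutoff_eq hχ0 hχ1 hε fun s hs => ?_
    have hd : dist ξ ξ₀ ≤ δ := Metric.dist_le_diam_of_mem hbdd hξ hξ₀
    have h1 : |‖ξ‖ - ‖ξ₀‖| ≤ δ := (abs_norm_sub_norm_le ξ ξ₀).trans (by rwa [← dist_eq_norm])
    have hξa := hsupp hξ
    have hξ₀a := hsupp hξ₀
    have hR : R ≤ |R| := le_abs_self R
    have h2 : |‖ξ‖ ^ 2 - ‖ξ₀‖ ^ 2| ≤ 2 * |R| * δ := by
      have : ‖ξ‖ ^ 2 - ‖ξ₀‖ ^ 2 = (‖ξ‖ + ‖ξ₀‖) * (‖ξ‖ - ‖ξ₀‖) := by ring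
      rw [this, abs_mul, abs_of_nonneg (by positivity)]
      gcongr
      linarith [hξa.2, hξ₀a.2]
    have h3 : r ^ 2 ≤ ‖ξ‖ ^ 2 := pow_le_pow_left₀ hr.le hξa.1 2
    have h4 : ‖ξ‖ ^ 2 ≤ R ^ 2 := pow_le_pow_left₀ (norm_nonneg _) hξa.2 2
    rw [abs_le] at h2
    rw [abs_lt] at hs
    have hr2 : 0 < r ^ 2 := by positivity
    exact ⟨⟨by nlinarith, by nlinarith⟩, ⟨by linarith, by linarith⟩⟩
  have hFi := integrable_multiplier_mul_fourier hr hw.continuousOn hu hsupp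
  set F : EuclideanSpace ℝ (Fin d) → ℂ := fun ξ =>
    (𝐞 (⟪ξ, x⟫ + σ * (ε ^ 2)⁻¹ * ‖ξ‖) : ℂ) * (w (‖ξ‖ ^ 2) * 𝓕 u ξ) with hF
  have hFi' : Integrable F := by
    refine hFi.bdd_mul (c := 1) (Continuous.aestronglyMeasurable
      (continuous_coe_fourierChar.comp (by fun_prop)))
      (Eventually.of_forall fun ξ => (norm_fourierChar _).le)
  have hχb : ∃ M, ∀ y, ‖(χ y : ℂ)‖ ≤ M := by
    obtain ⟨M, hM⟩ :=
      (hasCompactSupport_of_eq_zero hχ0).exists_bound_of_continuous hχ.continuous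
    exact ⟨M, fun y => by simpa using hM y⟩
  obtain ⟨M, hM⟩ := hχb
  have hχc := hχ.continuous
  have hprod : Integrable (Function.uncurry fun (ξ : EuclideanSpace ℝ (Fin d)) (s : ℝ) =>
      F ξ * χ ((‖ξ‖ ^ 2 - s) / ε)) (volume.prod (volume.restrict J)) := by
    have : IsFiniteMeasure (volume.restrict J) := ⟨by simpa using hJfin⟩
    have h1 : Integrable (fun z : EuclideanSpace ℝ (Fin d) × ℝ => F z.1)
        (volume.prod (volume.restrict J)) := hFi'.comp_fst _
    have h2 := h1.mul_bdd (g := fun z => (χ ((‖z.1‖ ^ 2 - z.2) / ε) : ℂ)) (c := M)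
      (Continuous.aestronglyMeasurable (by simp only [div_eq_mul_inv]; fun_prop))
      (Eventually.of_forall fun z => hM _)
    exact h2
  have havg : ε * halfWave σ w u (ε ^ 2)⁻¹ x = ∫ s in J, ∫ ξ, F ξ * χ ((‖ξ‖ ^ 2 - s) / ε) := by
    rw [← integral_integral_swap hprod, halfWave, ← integral_const_mul]
    refine integral_congr_ae (Eventually.of_forall fun ξ => ?_)
    simp only
    rw [integral_const_mul]
    by_cases hξ : ξ ∈ tsupport (𝓕 u)
    · have := hcut ξ hξ
      have h' : ∫ s in J, (χ ((‖ξ‖ ^ 2 - s) / ε) : ℂ) = (ε : ℂ) := by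
        rw [integral_complex_ofReal, this]
      rw [h', mul_comm]
    · simp [hF, image_eq_zero_of_notMem_tsupport hξ]
  have hnorm : ε * ‖halfWave σ w u (ε ^ 2)⁻¹ x‖ = ‖(ε : ℂ) * halfWave σ w u (ε ^ 2)⁻¹ x‖ := by
    rw [norm_mul, Complex.norm_real, Real.norm_of_nonneg hε.le]
  rw [hnorm, havg]
  refine (norm_setIntegral_le_of_norm_le_const hJfin fun s hs =>
    hC u hu hsupp x ε s hε hε' hs.2).trans ?_
  calc _ ≤ (C * ε ^ d * ∫ y, ‖u y‖) * (2 * (2 * |R| + 1) * δ) := by gcongr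
    _ = _ := by ring

/-- **Dispersive estimate for half-waves.** The decay exponent `d'` interpolates between the trivial
bound by the volume of the frequency support and the bound `O(δ t^{-(d-1)/2})`, where `δ` is the
diameter of the support. The former suffices as long as `δ√t` is bounded. -/
theorem exists_norm_halfWave_le (hd : 1 ≤ d) (hr : 0 < r) {σ : ℝ} (hσ : |σ| = 1) {w : ℝ → ℂ}
    (hw : ContDiffOn ℝ ∞ w (Ioi 0)) :
    ∃ C : ℝ, 0 ≤ C ∧ ∀ u : EuclideanSpace ℝ (Fin d) → ℂ, Integrable u →
      tsupport (𝓕 u) ⊆ annulus d r R → ∀ h : ℝ, Metric.diam (tsupport (𝓕 u)) ≤ h →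
      ∀ d' : ℝ, 0 ≤ d' → d' ≤ (d : ℝ) - 1 → ∀ t : ℝ, 0 < t → ∀ x : EuclideanSpace ℝ (Fin d),
      ‖halfWave σ w u t x‖ ≤ C * h ^ ((d : ℝ) - d') / t ^ (d' / 2) * ∫ y, ‖u y‖ := by
  obtain ⟨C₁, hC₁0, hC₁⟩ := exists_mul_norm_halfWave_le (d := d) (R := R) hr hσ hw
  obtain ⟨W, hW0, hW⟩ := exists_norm_multiplier_le (d := d) (R := R) hr hw.continuousOn
  set v : ℝ := volume.real (Metric.ball (0 : EuclideanSpace ℝ (Fin d)) 1) with hv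
  have hv0 : 0 ≤ v := measureReal_nonneg
  -- since `δ ≤ 2|R|`, the alternative `δ√t > K` forces `t^{-1/2} ≤ r²/4`
  set K : ℝ := max 1 (2 * |R| * (4 / r ^ 2)) with hK
  have hK1 : 1 ≤ K := le_max_left _ _
  refine ⟨W * v * K ^ ((d : ℝ) - 1) + C₁, by positivity, ?_⟩
  intro u hu hsupp h hdiam d' hd'0 hd'1 t ht x
  set δ := Metric.diam (tsupport (𝓕 u)) with hδ
  have hδ0 : 0 ≤ δ := Metric.diam_nonneg
  have hu0 : 0 ≤ ∫ y, ‖u y‖ := integral_nonneg fun _ => norm_nonneg _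
  have hsq : 0 < √t := Real.sqrt_pos.2 ht
  have htd : t ^ (d' / 2) = √t ^ d' := by
    rw [Real.sqrt_eq_rpow, ← Real.rpow_mul ht.le]; congr 1; ring
  -- the claim is monotone in `h`, so `h` may be replaced by the diameter, which is at most `2|R|`
  suffices hmain : ‖halfWave σ w u t x‖ ≤
      (W * v * K ^ ((d : ℝ) - 1) + C₁) * δ ^ ((d : ℝ) - d') / t ^ (d' / 2) * ∫ y, ‖u y‖ by
    refine hmain.trans ?_
    have : 0 ≤ (d : ℝ) - d' := by linarith
    gcongr
  rw [htd]
  have hsplit : δ ^ d = δ ^ ((d : ℝ) - d') / √t ^ d' * (δ * √t) ^ d' := by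
    rw [Real.mul_rpow hδ0 hsq.le]
    have h1 : √t ^ d' ≠ 0 := (Real.rpow_pos_of_pos hsq _).ne'
    have h2 : δ ^ d = δ ^ ((d : ℝ) - d') * δ ^ d' := by
      rw [← Real.rpow_add_of_nonneg hδ0 (by linarith) hd'0, ← Real.rpow_natCast]
      congr 1; ring
    rw [h2]; field_simp
  have hbdd : Bornology.IsBounded (tsupport (𝓕 u)) :=
    (hasCompactSupport_of_tsupport_subset_annulus hsupp).isBounded
  have hp0 : 0 ≤ δ ^ ((d : ℝ) - d') / √t ^ d' := by positivity
  have hK0 : 0 ≤ W * v * K ^ ((d : ℝ) - 1) := by positivity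
  rcases le_or_gt (δ * √t) K with hκ | hκ
  · -- the trivial bound suffices
    have htriv : ‖halfWave σ w u t x‖ ≤ W * (v * δ ^ d * ∫ y, ‖u y‖) := by
      have hsub : ∫ ξ, ‖𝓕 u ξ‖ ≤ v * δ ^ d * ∫ y, ‖u y‖ := by
        rcases (tsupport (𝓕 u)).eq_empty_or_nonempty with he | ⟨ξ₀, hξ₀⟩
        · have := integral_norm_fourier_le_of_tsupport_subset (u := u) (s := ∅) he.le (by simp)
          refine this.trans ?_
          simp only [measureReal_empty, zero_mul]
          positivity
        · have hball : tsupport (𝓕 u) ⊆ Metric.closedBall ξ₀ δ := fun ξ hξ =>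
            Metric.dist_le_diam_of_mem hbdd hξ hξ₀
          have := integral_norm_fourier_le_of_tsupport_subset hball measure_closedBall_lt_top
          refine this.trans (le_of_eq ?_)
          rw [Measure.real, Measure.addHaar_closedBall _ _ hδ0, finrank_euclideanSpace_fin,
            ENNReal.toReal_mul, ENNReal.toReal_ofReal (by positivity), hv, Measure.real]
          ring
      calc _ ≤ ∫ ξ, W * ‖𝓕 u ξ‖ := by
            refine norm_integral_le_of_norm_le
              ((integrable_fourier_of_tsupport_subset_annulus hu hsupp).norm.const_mul W)
              (Eventually.of_forall fun ξ => ?_)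
            rw [norm_mul, norm_fourierChar, one_mul, norm_mul]
            by_cases hξ : ξ ∈ tsupport (𝓕 u)
            · gcongr
              exact hW ξ (hsupp hξ)
            · simp [image_eq_zero_of_notMem_tsupport hξ]
        _ = W * ∫ ξ, ‖𝓕 u ξ‖ := integral_const_mul _ _
        _ ≤ _ := by gcongr
    have hKd : (δ * √t) ^ d' ≤ K ^ ((d : ℝ) - 1) :=
      (Real.rpow_le_rpow (by positivity) hκ hd'0).trans (Real.rpow_le_rpow_of_exponent_le hK1 hd'1)
    calc _ ≤ W * (v * δ ^ d * ∫ y, ‖u y‖) := htriv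
      _ = W * v * (δ ^ ((d : ℝ) - d') / √t ^ d') * (δ * √t) ^ d' * ∫ y, ‖u y‖ := by
          rw [hsplit]; ring
      _ ≤ W * v * (δ ^ ((d : ℝ) - d') / √t ^ d') * K ^ ((d : ℝ) - 1) * ∫ y, ‖u y‖ := by gcongr
      _ = (W * v * K ^ ((d : ℝ) - 1)) * (δ ^ ((d : ℝ) - d') / √t ^ d') * ∫ y, ‖u y‖ := by ring
      _ ≤ (W * v * K ^ ((d : ℝ) - 1) + C₁) * (δ ^ ((d : ℝ) - d') / √t ^ d') * ∫ y, ‖u y‖ := by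
          gcongr; linarith
      _ = _ := by ring
  · -- long times relative to the size of the support, with `ε = t^{-1/2}`
    have hκ1 : 1 ≤ δ * √t := hK1.trans hκ.le
    have hδR : δ ≤ 2 * |R| := by
      refine (Metric.diam_mono (hsupp.trans annulus_subset_closedBall)
        Metric.isBounded_closedBall).trans ?_
      refine (Metric.diam_mono (Metric.closedBall_subset_closedBall (le_abs_self R))
        Metric.isBounded_closedBall).trans ?_
      exact Metric.diam_closedBall (abs_nonneg R)
    set ε := (√t)⁻¹ with hε
    have hε0 : 0 < ε := by positivity
    have ht2 : (ε ^ 2)⁻¹ = t := by rw [hε, inv_pow, inv_inv, Real.sq_sqrt ht.le]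
    have hεr : ε ≤ r ^ 2 / 4 := by
      have h1 : 2 * |R| * (4 / r ^ 2) < 2 * |R| * √t :=
        lt_of_le_of_lt (le_max_right _ _) (hκ.trans_le (by gcongr))
      have h2 : 4 / r ^ 2 < √t := lt_of_mul_lt_mul_left h1 (by positivity)
      rw [hε, inv_le_comm₀ hsq (by positivity), inv_div]
      exact h2.le
    have hεδ : ε ≤ δ := by
      rw [hε, inv_le_iff_one_le_mul₀ hsq]; exact hκ1
    have key := hC₁ u hu hsupp x ε hε0 hεr hεδ
    rw [ht2] at key
    have hδpos : 0 < δ := lt_of_lt_of_le hε0 hεδ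
    have hkey : ‖halfWave σ w u t x‖ ≤ C₁ * (δ * ε ^ (d - 1)) * ∫ y, ‖u y‖ := by
      refine le_of_mul_le_mul_left (key.trans (le_of_eq ?_)) hε0
      obtain ⟨m, rfl⟩ : ∃ m, d = m + 1 := ⟨d - 1, by omega⟩
      simp only [Nat.add_sub_cancel, pow_succ]
      ring
    have hcmp : δ * ε ^ (d - 1) ≤ δ ^ ((d : ℝ) - d') / √t ^ d' := by
      rw [le_div_iff₀ (Real.rpow_pos_of_pos hsq _)]
      have e1 : ε ^ (d - 1) = √t ^ (-((d : ℝ) - 1)) := by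
        rw [hε, inv_pow, Real.rpow_neg hsq.le, ← Real.rpow_natCast, Nat.cast_sub hd, Nat.cast_one]
      have e2 : δ ^ ((d : ℝ) - d') = δ * δ ^ ((d : ℝ) - 1 - d') := by
        rw [← Real.rpow_one_add' hδ0 (by linarith)]; congr 1; ring
      rw [e1, mul_assoc, ← Real.rpow_add hsq, e2]
      gcongr
      calc √t ^ (-((d : ℝ) - 1) + d') = ε ^ ((d : ℝ) - 1 - d') := by
            rw [hε, Real.inv_rpow hsq.le, ← Real.rpow_neg hsq.le]; congr 1; ring
        _ ≤ _ := Real.rpow_le_rpow hε0.le hεδ (by linarith)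
    calc _ ≤ C₁ * (δ * ε ^ (d - 1)) * ∫ y, ‖u y‖ := hkey
      _ ≤ C₁ * (δ ^ ((d : ℝ) - d') / √t ^ d') * ∫ y, ‖u y‖ := by gcongr
      _ ≤ (W * v * K ^ ((d : ℝ) - 1) + C₁) * (δ ^ ((d : ℝ) - d') / √t ^ d') * ∫ y, ‖u y‖ := by
          gcongr; linarith
      _ = _ := by ring

end DispersiveEstimate

/-! ### Existence -/

section SecondDerivatives

open Filter Topology

variable {E F : Type*} [NormedAddCommGroup E] [NormedSpace ℝ E] [NormedAddCommGroup F]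
  [NormedSpace ℝ F] {U : ℝ × E → F}

theorem differentiable_fderiv_apply (hU : ContDiff ℝ 2 U) (a : ℝ × E) :
    Differentiable ℝ fun z => fderiv ℝ U z a :=
  ((hU.fderiv_right (m := 1) (by norm_num)).clm_apply contDiff_const).differentiable one_ne_zero

/-- The time derivative is the directional derivative along `(1, 0)`. -/
theorem hasDerivAt_time {z : ℝ × E} (hU : DifferentiableAt ℝ U z) :
    HasDerivAt (fun s => U (s, z.2)) (fderiv ℝ U z (1, 0)) z.1 := by
  have hl : HasDerivAt (fun s : ℝ => (s, z.2)) ((1 : ℝ), (0 : E)) z.1 :=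
    (hasDerivAt_id _).prodMk (hasDerivAt_const _ _)
  exact HasFDerivAt.comp_hasDerivAt (x := z.1) (f := fun s => (s, z.2)) (l := U)
    hU.hasFDerivAt hl

theorem hasFDerivAt_space {z : ℝ × E} (hU : DifferentiableAt ℝ U z) :
    HasFDerivAt (fun x => U (z.1, x))
      ((fderiv ℝ U z).comp (ContinuousLinearMap.inr ℝ ℝ E)) z.2 := by
  have hl : HasFDerivAt (fun x : E => (z.1, x)) (ContinuousLinearMap.inr ℝ ℝ E) z.2 :=
    hasFDerivAt_prodMk_right z.1 z.2
  exact HasFDerivAt.comp (x := z.2) (f := fun x => (z.1, x)) (g := U) hU.hasFDerivAt hl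

theorem iteratedDeriv_two_time (hU : ContDiff ℝ 2 U) (t : ℝ) (x : E) :
    iteratedDeriv 2 (fun s => U (s, x)) t =
      fderiv ℝ (fun z => fderiv ℝ U z (1, 0)) (t, x) (1, 0) := by
  have h1 : deriv (fun s => U (s, x)) = fun s => fderiv ℝ U (s, x) (1, 0) := by
    ext s
    exact (hasDerivAt_time (z := (s, x)) ((hU.differentiable two_ne_zero) _)).deriv
  rw [iteratedDeriv_succ, iteratedDeriv_one, h1]
  exact (hasDerivAt_time (U := fun z => fderiv ℝ U z (1, 0)) (z := (t, x))
    (differentiable_fderiv_apply hU _ _)).deriv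

end SecondDerivatives

section Existence

open Real Filter Topology
open scoped ContDiff RealInnerProductSpace

variable {d : ℕ}

theorem laplacian_space {F : Type*} [NormedAddCommGroup F] [NormedSpace ℝ F]
    {U : ℝ × EuclideanSpace ℝ (Fin d) → F} (hU : ContDiff ℝ 2 U) (t : ℝ)
    (x : EuclideanSpace ℝ (Fin d)) :
    Laplacian.laplacian (fun y => U (t, y)) x =
      ∑ i : Fin d, fderiv ℝ (fun z => fderiv ℝ U z (0, EuclideanSpace.basisFun (Fin d) ℝ i)) (t, x)
        (0, EuclideanSpace.basisFun (Fin d) ℝ i) := by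
  rw [InnerProductSpace.laplacian_eq_iteratedFDeriv_orthonormalBasis _
    (EuclideanSpace.basisFun (Fin d) ℝ)]
  refine Finset.sum_congr rfl fun i _ => ?_
  rw [iteratedFDeriv_two_apply]
  simp only [Matrix.cons_val_zero, Matrix.cons_val_one]
  set v := EuclideanSpace.basisFun (Fin d) ℝ i
  have hf : ContDiff ℝ 2 fun y => U (t, y) := hU.comp (contDiff_prodMk_right t)
  have hd : DifferentiableAt ℝ (fderiv ℝ fun y => U (t, y)) x :=
    ((hf.fderiv_right (m := 1) (by norm_num)).differentiable one_ne_zero) x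
  have h1 : fderiv ℝ (fderiv ℝ fun y => U (t, y)) x v v =
      fderiv ℝ (fun y => fderiv ℝ (fun y => U (t, y)) y v) x v := by
    rw [fderiv_clm_apply hd (differentiableAt_const v)]
    simp
  have h2 : (fun y => fderiv ℝ (fun y => U (t, y)) y v) = fun y => fderiv ℝ U (t, y) (0, v) := by
    ext y
    rw [(hasFDerivAt_space (z := (t, y)) ((hU.differentiable two_ne_zero) _)).fderiv]
    simp
  rw [h1, h2, (hasFDerivAt_space (U := fun z => fderiv ℝ U z (0, v)) (z := (t, x))
    (differentiable_fderiv_apply hU _ _)).fderiv]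
  simp

/-- The pairing of the frequency `(ρ, ξ)` with the point `(t, x)` that gives the phase of a
half-wave; the sign is the one of `VectorFourier.fourierIntegral`. -/
noncomputable def wavePairing (d : ℕ) (σ : ℝ) :
    (ℝ × EuclideanSpace ℝ (Fin d)) →L[ℝ] (ℝ × EuclideanSpace ℝ (Fin d)) →L[ℝ] ℝ :=
  -((σ • ContinuousLinearMap.mul ℝ ℝ).bilinearComp (.fst ℝ ℝ _) (.fst ℝ ℝ _) +
    (innerSL ℝ).bilinearComp (.snd ℝ ℝ _) (.snd ℝ ℝ _))

theorem wavePairing_apply (σ : ℝ) (p z : ℝ × EuclideanSpace ℝ (Fin d)) :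
    wavePairing d σ p z = -(⟪p.2, z.2⟫ + σ * z.1 * p.1) := by
  simp only [wavePairing, neg_apply, add_apply,
    ContinuousLinearMap.bilinearComp_apply, smul_apply,
    ContinuousLinearMap.mul_apply', ContinuousLinearMap.coe_fst', ContinuousLinearMap.coe_snd',
    smul_eq_mul, innerSL_apply_apply]
  ring

/-- Lebesgue measure on frequency space, carried by the light cone `ρ = |ξ|`. It makes the phase
`x·ξ + σtρ` bilinear, so that waves are Fourier integrals in the sense of `VectorFourier`. -/
noncomputable def coneMeasure (d : ℕ) : Measure (ℝ × EuclideanSpace ℝ (Fin d)) :=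
  volume.map fun ξ => (‖ξ‖, ξ)

theorem measurableEmbedding_cone :
    MeasurableEmbedding fun ξ : EuclideanSpace ℝ (Fin d) => (‖ξ‖, ξ) := by
  refine Topology.IsClosedEmbedding.measurableEmbedding ?_
  exact Topology.IsClosedEmbedding.of_continuous_injective_isClosedMap (by fun_prop)
    (fun a b h => (Prod.ext_iff.1 h).2)
    (Function.LeftInverse.isClosedEmbedding (f := Prod.snd) (fun ξ => rfl) continuous_snd
      (by fun_prop)).isClosedMap

/-- The wave `∫ e^{2πi(x·ξ + σt|ξ|)} F(ξ) dξ` as a function on space-time; `halfWave` is the case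
`F(ξ) = w(|ξ|²) û(ξ)`. -/
noncomputable def coneWave (σ : ℝ) (F : EuclideanSpace ℝ (Fin d) → ℂ)
    (z : ℝ × EuclideanSpace ℝ (Fin d)) : ℂ :=
  ∫ ξ, (𝐞 (⟪ξ, z.2⟫ + σ * z.1 * ‖ξ‖) : ℂ) * F ξ

theorem coneWave_eq_fourierIntegral (σ : ℝ) (F : EuclideanSpace ℝ (Fin d) → ℂ) :
    coneWave σ F = VectorFourier.fourierIntegral 𝐞 (coneMeasure d)
      (wavePairing d σ).toLinearMap₁₂ fun p => F p.2 := by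
  ext z
  rw [VectorFourier.fourierIntegral, coneMeasure, measurableEmbedding_cone.integral_map, coneWave]
  refine integral_congr_ae (Eventually.of_forall fun ξ => ?_)
  simp [wavePairing_apply, Circle.smul_def]

variable {F : EuclideanSpace ℝ (Fin d) → ℂ} {σ : ℝ}

theorem integrable_coneMeasure (hF : Continuous F) (hFs : HasCompactSupport F) (n : ℕ) :
    Integrable (fun p : ℝ × EuclideanSpace ℝ (Fin d) => ‖p‖ ^ n * ‖F p.2‖) (coneMeasure d) := by
  rw [coneMeasure, measurableEmbedding_cone.integrable_map_iff]
  refine Continuous.integrable_of_hasCompactSupport (by simp only [Function.comp_def]; fun_prop) ?_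
  exact hFs.norm.mul_left

theorem integrable_coneMeasure' (hF : Continuous F) (hFs : HasCompactSupport F) :
    Integrable (fun p : ℝ × EuclideanSpace ℝ (Fin d) => F p.2) (coneMeasure d) := by
  rw [coneMeasure, measurableEmbedding_cone.integrable_map_iff]
  exact hF.integrable_of_hasCompactSupport hFs

theorem contDiff_coneWave (hF : Continuous F) (hFs : HasCompactSupport F) :
    ContDiff ℝ 2 (coneWave σ F) := by
  rw [coneWave_eq_fourierIntegral]
  exact VectorFourier.contDiff_fourierIntegral (N := 2) _
    (fun n _ => integrable_coneMeasure hF hFs n)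

/-- Differentiating a wave multiplies its profile by a symbol, which is again a wave. -/
theorem fderiv_coneWave (hF : Continuous F) (hFs : HasCompactSupport F)
    (z a : ℝ × EuclideanSpace ℝ (Fin d)) :
    fderiv ℝ (coneWave σ F) z a =
      coneWave σ (fun ξ => 2 * π * Complex.I * (⟪ξ, a.2⟫ + σ * a.1 * ‖ξ‖ : ℝ) * F ξ) z := by
  rw [coneWave_eq_fourierIntegral]
  have h1 := integrable_coneMeasure' hF hFs
  have h2 := integrable_coneMeasure hF hFs 1
  simp only [pow_one] at h2
  rw [VectorFourier.fderiv_fourierIntegral (wavePairing d σ) h1 h2,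
    Real.fourierIntegral_continuousLinearMap_apply']
  · rw [VectorFourier.fourierIntegral, coneMeasure, measurableEmbedding_cone.integral_map, coneWave]
    refine integral_congr_ae (Eventually.of_forall fun ξ => ?_)
    simp only [ContinuousLinearMap.toLinearMap₁₂_apply_apply_apply, wavePairing_apply, neg_neg,
      Circle.smul_def, VectorFourier.fourierSMulRight_apply, smul_eq_mul, Complex.real_smul]
    push_cast
    ring
  · refine (h2.const_mul (2 * π * ‖wavePairing d σ‖)).mono' h1.1.fourierSMulRight
      (Eventually.of_forall fun p => ?_)
    rw [← mul_assoc]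
    exact VectorFourier.norm_fourierSMulRight_le _ _ _

theorem wave_coneWave (hσ : |σ| = 1) (hF : Continuous F) (hFs : HasCompactSupport F)
    (z : ℝ × EuclideanSpace ℝ (Fin d)) :
    fderiv ℝ (fun z => fderiv ℝ (coneWave σ F) z (1, 0)) z (1, 0) =
      ∑ i : Fin d, fderiv ℝ (fun z => fderiv ℝ (coneWave σ F) z
        (0, EuclideanSpace.basisFun (Fin d) ℝ i)) z (0, EuclideanSpace.basisFun (Fin d) ℝ i) := by
  have hc : ∀ a : ℝ × EuclideanSpace ℝ (Fin d), Continuous fun ξ : EuclideanSpace ℝ (Fin d) =>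
      2 * π * Complex.I * (⟪ξ, a.2⟫ + σ * a.1 * ‖ξ‖ : ℝ) * F ξ := fun a => by fun_prop
  have hs : ∀ a : ℝ × EuclideanSpace ℝ (Fin d), HasCompactSupport
      fun ξ : EuclideanSpace ℝ (Fin d) =>
      2 * π * Complex.I * (⟪ξ, a.2⟫ + σ * a.1 * ‖ξ‖ : ℝ) * F ξ := fun a => hFs.mul_left
  have hD : ∀ a, fderiv ℝ (fun z => fderiv ℝ (coneWave σ F) z a) z a =
      ∫ ξ, (𝐞 (⟪ξ, z.2⟫ + σ * z.1 * ‖ξ‖) : ℂ) * ((2 * π * Complex.I) ^ 2 *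
        ((⟪ξ, a.2⟫ + σ * a.1 * ‖ξ‖) ^ 2 : ℝ) * F ξ) := by
    intro a
    simp only [fderiv_coneWave hF hFs]
    rw [fderiv_coneWave (hc a) (hs a), coneWave]
    refine integral_congr_ae (Eventually.of_forall fun ξ => ?_)
    simp only
    push_cast
    ring
  simp only [hD]
  rw [← integral_finsetSum]
  · refine integral_congr_ae (Eventually.of_forall fun ξ => ?_)
    simp only
    rw [← Finset.mul_sum, ← Finset.sum_mul, ← Finset.mul_sum, ← Complex.ofReal_sum]
    congr 5
    have h1 : ‖ξ‖ ^ 2 = ∑ i, ξ i ^ 2 := EuclideanSpace.real_norm_sq_eq ξ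
    have h2 : σ ^ 2 = 1 := by rw [← sq_abs, hσ, one_pow]
    simp only [inner_zero_right, zero_add, mul_one, mul_zero, zero_mul, add_zero, mul_pow, h2,
      one_mul, h1]
    refine Finset.sum_congr rfl fun i _ => ?_
    simp [EuclideanSpace.inner_single_right]
  · intro i _
    refine Continuous.integrable_of_hasCompactSupport ?_ (hFs.mul_left.mul_left)
    exact (continuous_coe_fourierChar.comp (by fun_prop)).mul (by fun_prop)

end Existence

/-! ### Uniqueness by the energy method -/

section Energy

open Filter Topology Set
open scoped RealInnerProductSpace

variable {d : ℕ} {A : ℝ}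

/-- Differentiation under the integral sign and the divergence theorem for functions on space-time
that vanish outside the light cone with vertex `(A, 0)`. -/
theorem integral_calculus_of_cone_support {G : ℝ × EuclideanSpace ℝ (Fin d) → ℝ}
    (hG : ContDiff ℝ 1 G)
    (hG0 : ∀ z, |A - z.1| ≤ ‖z.2‖ → G z = 0) (t : ℝ) :
    HasDerivAt (fun s => ∫ x, G (s, x)) (∫ x, fderiv ℝ G (t, x) (1, 0)) t ∧
      (∀ a, Integrable fun x => fderiv ℝ G (t, x) a) ∧
      ∀ v, ∫ x, fderiv ℝ G (t, x) (0, v) = 0 := by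
  have hGd : Differentiable ℝ G := hG.differentiable one_ne_zero
  have hG'c : ∀ a, Continuous fun z => fderiv ℝ G z a := fun a =>
    (hG.continuous_fderiv one_ne_zero).clm_apply continuous_const
  have hG'0 : ∀ z a, |A - z.1| < ‖z.2‖ → fderiv ℝ G z a = 0 := by
    intro z a hz
    have hopen : IsOpen {z : ℝ × EuclideanSpace ℝ (Fin d) | |A - z.1| < ‖z.2‖} :=
      isOpen_lt (by fun_prop) (by fun_prop)
    have : G =ᶠ[𝓝 z] fun _ => 0 := by
      filter_upwards [hopen.mem_nhds hz] with y hy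
      exact hG0 y (le_of_lt hy)
    rw [this.fderiv_eq]
    simp
  have hsupp : ∀ f : ℝ × EuclideanSpace ℝ (Fin d) → ℝ,
      (∀ z, |A - z.1| < ‖z.2‖ → f z = 0) → ∀ s, HasCompactSupport fun x => f (s, x) := by
    intro f hf s
    refine .intro (isCompact_closedBall 0 |A - s|) fun x hx => hf (s, x) ?_
    simpa using hx
  have hGs := hsupp G fun z hz => hG0 z hz.le
  have hint : ∀ s, Integrable fun x => G (s, x) := fun s =>
    (hG.continuous.comp (Continuous.prodMk_right s)).integrable_of_hasCompactSupport (hGs s)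
  have hint' : ∀ s a, Integrable fun x => fderiv ℝ G (s, x) a := fun s a =>
    ((hG'c a).comp (Continuous.prodMk_right s)).integrable_of_hasCompactSupport
      (hsupp _ (fun z hz => hG'0 z a hz) s)
  refine ⟨?_, hint' t, ?_⟩
  · set ρ := |A - t| + 1
    obtain ⟨M, hM⟩ := ((isCompact_closedBall t 1).prod
      (isCompact_closedBall (0 : EuclideanSpace ℝ (Fin d)) ρ)).exists_bound_of_continuousOn
      (hG'c (1, 0)).continuousOn
    have hM0 : 0 ≤ M := (norm_nonneg _).trans (hM (t, 0)
      ⟨Metric.mem_closedBall_self zero_le_one, Metric.mem_closedBall_self (by positivity)⟩)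
    refine (hasDerivAt_integral_of_dominated_loc_of_deriv_le
      (F := fun s x => G (s, x)) (F' := fun s x => fderiv ℝ G (s, x) (1, 0))
      (bound := indicator (Metric.closedBall 0 ρ) fun _ => M)
      (Metric.closedBall_mem_nhds t one_pos) (Eventually.of_forall fun s => (hint s).1) (hint t)
      (hint' t _).1 (Eventually.of_forall fun x s hs => ?_) ?_
      (Eventually.of_forall fun x s _ => ?_)).2
    · by_cases hx : x ∈ Metric.closedBall (0 : EuclideanSpace ℝ (Fin d)) ρ
      · rw [indicator_of_mem hx]
        exact hM (s, x) ⟨hs, hx⟩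
      · rw [indicator_of_notMem hx, hG'0, norm_zero]
        simp only [Metric.mem_closedBall, dist_zero_right, not_le, Real.dist_eq] at hx hs ⊢
        have h1 : |A - s| ≤ |A - t| + |t - s| := abs_sub_le _ _ _
        rw [abs_sub_comm t s] at h1
        linarith
    · exact (integrable_indicator_iff measurableSet_closedBall).2
        (integrableOn_const measure_closedBall_lt_top.ne)
    · exact hasDerivAt_time (z := (s, x)) (hGd _)
  · intro v
    have hd : ∀ x, fderiv ℝ G (t, x) (0, v) = fderiv ℝ (fun y => G (t, y)) x v := by
      intro x
      rw [(hasFDerivAt_space (z := (t, x)) (hGd _)).fderiv]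
      simp
    have hibp := integral_mul_fderiv_eq_neg_fderiv_mul_of_integrable (μ := volume)
      (f := fun _ : EuclideanSpace ℝ (Fin d) => (1 : ℝ)) (g := fun x => G (t, x)) (v := v)
      (by simp) (by simpa [← hd] using hint' t (0, v)) (by simpa using hint t)
      (fun _ _ => differentiableAt_const _)
      (fun x _ => (hasFDerivAt_space (z := (t, x)) (hGd _)).differentiableAt)
    simpa [hd] using hibp

theorem hasDerivAt_sq_posPart (y : ℝ) :
    HasDerivAt (fun y : ℝ => (max y 0) ^ 2) (2 * max y 0) y := by
  rcases lt_trichotomy y 0 with hy | rfl | hy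
  · rw [max_eq_right hy.le, mul_zero]
    refine (hasDerivAt_const y (0 : ℝ)).congr_of_eventuallyEq ?_
    filter_upwards [Iio_mem_nhds hy] with z hz
    rw [max_eq_right (le_of_lt hz)]; simp
  · rw [hasDerivAt_iff_isLittleO_nhds_zero]
    simp only [zero_add, max_self, mul_zero, smul_zero, sub_zero, ne_eq, OfNat.ofNat_ne_zero,
      not_false_eq_true, zero_pow]
    refine Asymptotics.IsBigO.trans_isLittleO (g := fun h : ℝ => h ^ 2) ?_ ?_
    · refine Asymptotics.IsBigO.of_bound 1 (Eventually.of_forall fun h => ?_)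
      rw [one_mul, norm_pow, norm_pow]
      gcongr
      rw [Real.norm_eq_abs, Real.norm_eq_abs, abs_of_nonneg (le_max_right _ _)]
      exact max_le (le_abs_self h) (abs_nonneg h)
    · simpa using Asymptotics.isLittleO_pow_pow (𝕜 := ℝ) (m := 1) (n := 2) (by norm_num)
  · rw [max_eq_left hy.le]
    refine HasDerivAt.congr_of_eventuallyEq (f := fun y : ℝ => y ^ 2)
      (by simpa using hasDerivAt_pow 2 y) ?_
    filter_upwards [Ioi_mem_nhds hy] with z hz
    rw [max_eq_left (le_of_lt hz)]

theorem contDiff_sq_posPart : ContDiff ℝ 1 fun y : ℝ => (max y 0) ^ 2 := by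
  rw [contDiff_one_iff_deriv]
  refine ⟨fun y => (hasDerivAt_sq_posPart y).differentiableAt, ?_⟩
  have : deriv (fun y : ℝ => (max y 0) ^ 2) = fun y => 2 * max y 0 :=
    funext fun y => (hasDerivAt_sq_posPart y).deriv
  rw [this]
  fun_prop

/-- The weight `((A - t)² - |x|²)₊²`, supported in the light cone with vertex `(A, 0)`. -/
noncomputable def coneWeight (A : ℝ) (z : ℝ × EuclideanSpace ℝ (Fin d)) : ℝ :=
  (max ((A - z.1) ^ 2 - ‖z.2‖ ^ 2) 0) ^ 2

theorem contDiff_coneWeight :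
    ContDiff ℝ 1 (coneWeight A : ℝ × EuclideanSpace ℝ (Fin d) → ℝ) := by
  have h : ContDiff ℝ 1 fun z : ℝ × EuclideanSpace ℝ (Fin d) => (A - z.1) ^ 2 - ‖z.2‖ ^ 2 :=
    ((contDiff_const.sub contDiff_fst).pow 2).sub (contDiff_snd.norm_sq ℝ)
  exact contDiff_sq_posPart.comp h

theorem fderiv_coneWeight (z a : ℝ × EuclideanSpace ℝ (Fin d)) :
    fderiv ℝ (coneWeight A) z a =
      2 * max ((A - z.1) ^ 2 - ‖z.2‖ ^ 2) 0 * (-2 * (A - z.1) * a.1 - 2 * ⟪z.2, a.2⟫) := by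
  have h1 : HasFDerivAt (fun z : ℝ × EuclideanSpace ℝ (Fin d) => (A - z.1) ^ 2 - ‖z.2‖ ^ 2)
      (((2 * (A - z.1)) • -(ContinuousLinearMap.fst ℝ ℝ (EuclideanSpace ℝ (Fin d)))) -
        (2 • (innerSL ℝ z.2).comp (ContinuousLinearMap.snd ℝ ℝ (EuclideanSpace ℝ (Fin d))))) z := by
    refine HasFDerivAt.sub ?_ ?_
    · have := (hasFDerivAt_fst (𝕜 := ℝ) (p := z)).const_sub A |>.pow 2
      simpa using this
    · exact (hasFDerivAt_snd (𝕜 := ℝ) (p := z)).norm_sq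
  have h2 := (hasDerivAt_sq_posPart ((A - z.1) ^ 2 - ‖z.2‖ ^ 2)).comp_hasFDerivAt z h1
  have h3 : fderiv ℝ (coneWeight A) z = _ := h2.fderiv
  rw [h3]
  simp

theorem coneWeight_eq_zero {z : ℝ × EuclideanSpace ℝ (Fin d)} (hz : |A - z.1| ≤ ‖z.2‖) :
    coneWeight A z = 0 := by
  have : (A - z.1) ^ 2 ≤ ‖z.2‖ ^ 2 := by rw [← sq_abs]; gcongr
  rw [coneWeight, max_eq_right (by linarith)]
  simp

theorem coneWeight_pos {z : ℝ × EuclideanSpace ℝ (Fin d)} (hz : ‖z.2‖ < A - z.1) :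
    0 < coneWeight A z := by
  have : ‖z.2‖ ^ 2 < (A - z.1) ^ 2 := by gcongr
  have h : 0 < (A - z.1) ^ 2 - ‖z.2‖ ^ 2 := by linarith
  rw [coneWeight, max_eq_left h.le]
  positivity

/-- The energy flux through the light cone has a sign, because `2 T x·p ≤ |x| (T² + |p|²)`. -/
theorem two_mul_flux_le {a T : ℝ} {x : EuclideanSpace ℝ (Fin d)} {p : Fin d → ℝ} (ha : 0 ≤ a)
    (hx : ‖x‖ ≤ a) : 2 * T * ∑ i, x i * p i ≤ a * (T ^ 2 + ∑ i, p i ^ 2) := by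
  have h1 : (∑ i, x i * p i) ^ 2 ≤ a ^ 2 * ∑ i, p i ^ 2 := by
    refine (Finset.sum_mul_sq_le_sq_mul_sq _ _ _).trans ?_
    rw [← EuclideanSpace.real_norm_sq_eq]
    gcongr
  rcases ha.eq_or_lt with rfl | ha
  · have : ∑ i, x i * p i = 0 := by
      have := le_antisymm (by simpa using h1) (sq_nonneg (∑ i, x i * p i))
      simpa using this
    simp [this]
  · refine le_of_mul_le_mul_left ?_ ha
    nlinarith [sq_nonneg (a * T - ∑ i, x i * p i)]

/-- A real `C²` solution of the wave equation with vanishing Cauchy data vanishes in the future. The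
weighted energy `∫ ((A - t)² - |x|²)₊² (|∂ₜU|² + |∇U|²) dx` is nonincreasing in `t ≤ A`. -/
theorem eq_zero_of_wave_of_nonneg {U : ℝ × EuclideanSpace ℝ (Fin d) → ℝ} (hU : ContDiff ℝ 2 U)
    (hwave : ∀ z, fderiv ℝ (fun z => fderiv ℝ U z (1, 0)) z (1, 0) =
      ∑ i : Fin d, fderiv ℝ (fun z => fderiv ℝ U z (0, EuclideanSpace.basisFun (Fin d) ℝ i)) z
        (0, EuclideanSpace.basisFun (Fin d) ℝ i))
    (h0 : ∀ x, U (0, x) = 0) (h1 : ∀ x, fderiv ℝ U (0, x) (1, 0) = 0)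
    {t : ℝ} (ht : 0 ≤ t) (x : EuclideanSpace ℝ (Fin d)) : U (t, x) = 0 := by
  set e : Fin d → EuclideanSpace ℝ (Fin d) := fun i => EuclideanSpace.basisFun (Fin d) ℝ i with he
  set T : ℝ × EuclideanSpace ℝ (Fin d) → ℝ := fun z => fderiv ℝ U z (1, 0) with hT
  set p : Fin d → ℝ × EuclideanSpace ℝ (Fin d) → ℝ := fun i z => fderiv ℝ U z (0, e i) with hp
  have hU1 : ContDiff ℝ 1 (fderiv ℝ U) := hU.fderiv_right (by norm_num)
  have hTc : ContDiff ℝ 1 T := hU1.clm_apply contDiff_const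
  have hpc : ∀ i, ContDiff ℝ 1 (p i) := fun i => hU1.clm_apply contDiff_const
  have hTd : Differentiable ℝ T := hTc.differentiable one_ne_zero
  have hpd : ∀ i, Differentiable ℝ (p i) := fun i => (hpc i).differentiable one_ne_zero
  have hUd : Differentiable ℝ U := hU.differentiable two_ne_zero
  have hsymm : ∀ i z, fderiv ℝ (p i) z (1, 0) = fderiv ℝ T z (0, e i) := by
    intro i z
    have hs : IsSymmSndFDerivAt ℝ U z := hU.contDiffAt.isSymmSndFDerivAt (by simp)
    have hd : DifferentiableAt ℝ (fderiv ℝ U) z := hU1.differentiable one_ne_zero z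
    have hap : ∀ a b, fderiv ℝ (fun z => fderiv ℝ U z a) z b = fderiv ℝ (fderiv ℝ U) z b a := by
      intro a b
      rw [fderiv_clm_apply hd (differentiableAt_const a)]
      simp
    rw [hp, hT, hap, hap]
    exact hs _ _
  -- the weighted energy vanishes for every choice of the vertex `(A, 0)` of the cone
  have hvanish : ∀ A t : ℝ, 0 ≤ t → t ≤ A → ∀ x, ‖x‖ < A - t → T (t, x) = 0 := by
    intro A t ht htA x hx
    set en : ℝ × EuclideanSpace ℝ (Fin d) → ℝ := fun z => T z ^ 2 + ∑ i, p i z ^ 2 with hen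
    have henc : ContDiff ℝ 1 en := (hTc.pow 2).add (ContDiff.sum fun i _ => (hpc i).pow 2)
    have hen0 : ∀ z, 0 ≤ en z := fun z =>
      add_nonneg (sq_nonneg _) (Finset.sum_nonneg fun i _ => sq_nonneg _)
    have hψ := contDiff_coneWeight (d := d) (A := A)
    have hψd : Differentiable ℝ (coneWeight A : ℝ × EuclideanSpace ℝ (Fin d) → ℝ) :=
      hψ.differentiable one_ne_zero
    set G : ℝ × EuclideanSpace ℝ (Fin d) → ℝ := fun z => coneWeight A z * en z with hG
    set X : Fin d → ℝ × EuclideanSpace ℝ (Fin d) → ℝ := fun i z =>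
      coneWeight A z * (T z * p i z) with hX
    have hGc : ContDiff ℝ 1 G := hψ.mul henc
    have hXc : ∀ i, ContDiff ℝ 1 (X i) := fun i => hψ.mul (hTc.mul (hpc i))
    have hG' : ∀ z, fderiv ℝ G z (1, 0) = fderiv ℝ (coneWeight A) z (1, 0) * en z +
        coneWeight A z * (2 * T z * fderiv ℝ T z (1, 0) +
          ∑ i, 2 * p i z * fderiv ℝ (p i) z (1, 0)) := by
      intro z
      have hen' : HasFDerivAt en ((2 * T z) • fderiv ℝ T z +
          ∑ i, (2 * p i z) • fderiv ℝ (p i) z) z := by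
        refine HasFDerivAt.add ?_ (HasFDerivAt.fun_sum fun i _ => ?_)
        · simpa using (hTd z).hasFDerivAt.pow 2
        · simpa using (hpd i z).hasFDerivAt.pow 2
      have h : fderiv ℝ G z = _ := ((hψd z).hasFDerivAt.mul hen').fderiv
      rw [h]
      simp
      ring
    have hX' : ∀ i z, fderiv ℝ (X i) z (0, e i) = fderiv ℝ (coneWeight A) z (0, e i) *
        (T z * p i z) + coneWeight A z *
          (fderiv ℝ T z (0, e i) * p i z + T z * fderiv ℝ (p i) z (0, e i)) := by
      intro i z
      have h : fderiv ℝ (X i) z = _ :=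
        ((hψd z).hasFDerivAt.mul ((hTd z).hasFDerivAt.mul (hpd i z).hasFDerivAt)).fderiv
      rw [h]
      simp
      ring
    have hGcalc := integral_calculus_of_cone_support (A := A) hGc
      (fun z hz => by rw [hG]; simp [coneWeight_eq_zero hz])
    have hXcalc := fun i => integral_calculus_of_cone_support (A := A) (hXc i)
      (fun z hz => by rw [hX]; simp [coneWeight_eq_zero hz])
    -- with `q = ((A - s)² - |x|²)₊`, the difference of the two sides is
    -- `-4q ((A - s)(T² + |p|²) - 2T x·p)`
    have hle : ∀ s ≤ A, ∀ x, fderiv ℝ G (s, x) (1, 0) ≤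
        2 * ∑ i, fderiv ℝ (X i) (s, x) (0, e i) := by
      intro s hs x
      set q := max ((A - s) ^ 2 - ‖x‖ ^ 2) 0 with hq
      have hq0 : 0 ≤ q := le_max_right _ _
      have hflux : q * (2 * T (s, x) * ∑ i, x i * p i (s, x)) ≤ q * ((A - s) * en (s, x)) := by
        rcases hq0.eq_or_lt with h | h
        · rw [← h]; simp
        · have hxs : ‖x‖ ≤ A - s := by
            have : 0 < (A - s) ^ 2 - ‖x‖ ^ 2 := by
              by_contra hc
              rw [hq, max_eq_right (not_lt.1 hc)] at h
              exact lt_irrefl _ h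
            exact le_of_lt (lt_of_pow_lt_pow_left₀ 2 (by linarith) (by linarith))
          exact mul_le_mul_of_nonneg_left (two_mul_flux_le (by linarith) hxs) hq0
      have hwz : fderiv ℝ T (s, x) (1, 0) = ∑ i, fderiv ℝ (p i) (s, x) (0, e i) := hwave (s, x)
      have hin : ∀ i, ⟪x, e i⟫ = x i := fun i => by
        simp [he, EuclideanSpace.inner_single_right]
      rw [hG']
      simp only [hX', hsymm, fderiv_coneWeight, hwz, ← hq, hin, inner_zero_right, mul_zero,
        mul_one, sub_zero, zero_sub]
      have e1 : ∑ i, (2 * q * (-(2 * x i)) * (T (s, x) * p i (s, x)) + coneWeight A (s, x) *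
          (fderiv ℝ T (s, x) (0, e i) * p i (s, x) +
            T (s, x) * fderiv ℝ (p i) (s, x) (0, e i))) =
          -(2 * (q * (2 * T (s, x) * ∑ i, x i * p i (s, x)))) + coneWeight A (s, x) *
            (T (s, x) * ∑ i, fderiv ℝ (p i) (s, x) (0, e i) +
              ∑ i, p i (s, x) * fderiv ℝ T (s, x) (0, e i)) := by
        simp only [Finset.mul_sum, ← Finset.sum_add_distrib, ← Finset.sum_neg_distrib]
        exact Finset.sum_congr rfl fun i _ => by ring
      have e2 : ∑ i, 2 * p i (s, x) * fderiv ℝ T (s, x) (0, e i) =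
          2 * ∑ i, p i (s, x) * fderiv ℝ T (s, x) (0, e i) := by
        rw [Finset.mul_sum]
        exact Finset.sum_congr rfl fun i _ => by ring
      rw [e1, e2]
      linarith
    have hderiv : ∀ s ≤ A, ∫ x, fderiv ℝ G (s, x) (1, 0) ≤ 0 := by
      intro s hs
      calc _ ≤ ∫ x, 2 * ∑ i, fderiv ℝ (X i) (s, x) (0, e i) :=
            integral_mono ((hGcalc s).2.1 _)
              ((integrable_finsetSum _ fun i _ => (hXcalc i s).2.1 _).const_mul 2) (hle s hs)
        _ = 0 := by
            rw [integral_const_mul, integral_finsetSum _ fun i _ => (hXcalc i s).2.1 _]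
            simp [(hXcalc _ s).2.2]
    have hanti : AntitoneOn (fun s => ∫ x, G (s, x)) (Iic A) := by
      refine antitoneOn_of_deriv_nonpos (convex_Iic A)
        (fun s _ => (hGcalc s).1.continuousAt.continuousWithinAt)
        (fun s _ => (hGcalc s).1.differentiableAt.differentiableWithinAt) fun s hs => ?_
      rw [(hGcalc s).1.deriv]
      have hs' : s ∈ Iic A := interior_subset hs
      exact hderiv s hs'
    have hstart : ∫ x, G (0, x) = 0 := by
      have : ∀ x, G (0, x) = 0 := by
        intro x
        have hTx : T (0, x) = 0 := h1 x
        have hpx : ∀ i, p i (0, x) = 0 := by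
          intro i
          have h2 := (hasFDerivAt_space (z := ((0 : ℝ), x)) (hUd _)).fderiv
          have h3 : (fun y => U ((0 : ℝ), y)) = fun _ => 0 := funext h0
          simp only [h3] at h2
          have h4 := congrArg (fun l => l (e i)) h2
          simp only [fderiv_fun_const, Pi.zero_apply, zero_apply,
            ContinuousLinearMap.comp_apply, ContinuousLinearMap.inr_apply] at h4
          exact h4.symm
        simp [hG, hen, hTx, hpx]
      simp [this]
    have hGt : ∫ x, G (t, x) ≤ 0 := by
      have := hanti (show (0 : ℝ) ∈ Iic A from ht.trans htA) (show t ∈ Iic A from htA) ht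
      simpa [hstart] using this
    by_contra hne
    have hGne : G (t, x) ≠ 0 := by
      have h2 : 0 < en (t, x) := add_pos_of_pos_of_nonneg (by positivity)
        (Finset.sum_nonneg fun i _ => sq_nonneg _)
      exact (mul_pos (coneWeight_pos (z := (t, x)) hx) h2).ne'
    have hGs : HasCompactSupport fun x => G (t, x) := by
      refine .intro (isCompact_closedBall 0 |A - t|) fun y hy => ?_
      have : |A - t| < ‖y‖ := by simpa using hy
      rw [hG]
      simp [coneWeight_eq_zero (z := (t, y)) this.le]
    have := Continuous.integral_pos_of_hasCompactSupport_nonneg_nonzero (μ := volume)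
      (hGc.continuous.comp (Continuous.prodMk_right t)) hGs
      (fun y => mul_nonneg (sq_nonneg _) (hen0 _)) hGne
    exact absurd hGt (not_le.2 this)
  have hconst := constant_of_has_deriv_right_zero (f := fun s => U (s, x)) (a := 0) (b := t)
    (hU.continuous.comp (Continuous.prodMk_left x)).continuousOn
    (fun s hs => by
      have h2 := hasDerivAt_time (z := (s, x)) (hUd _)
      have h3 : fderiv ℝ U (s, x) (1, 0) = 0 :=
        hvanish (s + ‖x‖ + 1) s hs.1 (by linarith [norm_nonneg x]) x (by linarith)
      rw [h3] at h2
      exact h2.hasDerivWithinAt)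
  have := hconst t ⟨ht, le_rfl⟩
  simpa [h0] using this

end Energy

section Uniqueness

open Filter Topology Set
open scoped RealInnerProductSpace

variable {d : ℕ} {u₀ u₁ v₀ v₁ : EuclideanSpace ℝ (Fin d) → ℂ}
  {u v : ℝ → EuclideanSpace ℝ (Fin d) → ℂ}

theorem IsSolution.fderiv_eq (h : IsSolution u₀ u₁ u) (z : ℝ × EuclideanSpace ℝ (Fin d)) :
    fderiv ℝ (fun z => fderiv ℝ (fun p : ℝ × EuclideanSpace ℝ (Fin d) => u p.1 p.2) z (1, 0)) z
        (1, 0) =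
      ∑ i : Fin d, fderiv ℝ (fun z => fderiv ℝ
        (fun p : ℝ × EuclideanSpace ℝ (Fin d) => u p.1 p.2) z
        (0, EuclideanSpace.basisFun (Fin d) ℝ i)) z (0, EuclideanSpace.basisFun (Fin d) ℝ i) := by
  have h1 := h.wave_eq z.1 z.2
  have h2 := iteratedDeriv_two_time h.contDiff z.1 z.2
  have h3 := laplacian_space h.contDiff z.1 z.2
  simp only [Prod.mk.eta] at h2 h3
  rw [← h2, ← h3]
  exact sub_eq_zero.1 h1

theorem contDiff_time {U : ℝ × EuclideanSpace ℝ (Fin d) → ℂ} (hU : ContDiff ℝ 2 U)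
    (x : EuclideanSpace ℝ (Fin d)) : ContDiff ℝ 2 fun s => U (s, x) :=
  hU.comp (contDiff_prodMk_left x)

theorem contDiff_space {U : ℝ × EuclideanSpace ℝ (Fin d) → ℂ} (hU : ContDiff ℝ 2 U) (t : ℝ) :
    ContDiff ℝ 2 fun x => U (t, x) :=
  hU.comp (contDiff_prodMk_right t)

theorem IsSolution.add (hu : IsSolution u₀ u₁ u) (hv : IsSolution v₀ v₁ v) :
    IsSolution (fun x => u₀ x + v₀ x) (fun x => u₁ x + v₁ x) fun t x => u t x + v t x where
  contDiff := hu.contDiff.add hv.contDiff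
  wave_eq t x := by
    have h1 := iteratedDeriv_fun_add (x := t) (n := 2) (contDiff_time hu.contDiff x).contDiffAt
      (contDiff_time hv.contDiff x).contDiffAt
    have h2 := (contDiff_space hu.contDiff t).contDiffAt (x := x) |>.laplacian_add
      ((contDiff_space hv.contDiff t).contDiffAt (x := x))
    have h3 : Laplacian.laplacian (fun x => u t x + v t x) x =
      Laplacian.laplacian (u t) x + Laplacian.laplacian (v t) x := h2
    rw [h1, h3]
    linear_combination hu.wave_eq t x + hv.wave_eq t x
  initial := by
    filter_upwards [hu.initial, hv.initial] with x h1 h2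
    rw [h1, h2]
  initial_deriv := by
    filter_upwards [hu.initial_deriv, hv.initial_deriv] with x h1 h2
    rw [← h1, ← h2]
    exact deriv_fun_add ((contDiff_time hu.contDiff x).differentiable two_ne_zero _)
      ((contDiff_time hv.contDiff x).differentiable two_ne_zero _)

theorem IsSolution.sub (hu : IsSolution u₀ u₁ u) (hv : IsSolution v₀ v₁ v) :
    IsSolution (fun x => u₀ x - v₀ x) (fun x => u₁ x - v₁ x) fun t x => u t x - v t x where
  contDiff := hu.contDiff.sub hv.contDiff
  wave_eq t x := by
    have h1 := iteratedDeriv_fun_sub (x := t) (n := 2) (contDiff_time hu.contDiff x).contDiffAt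
      (contDiff_time hv.contDiff x).contDiffAt
    have h2 := (contDiff_space hu.contDiff t).contDiffAt (x := x) |>.laplacian_sub
      ((contDiff_space hv.contDiff t).contDiffAt (x := x))
    have h3 : Laplacian.laplacian (fun x => u t x - v t x) x =
      Laplacian.laplacian (u t) x - Laplacian.laplacian (v t) x := h2
    rw [h1, h3]
    linear_combination hu.wave_eq t x - hv.wave_eq t x
  initial := by
    filter_upwards [hu.initial, hv.initial] with x h1 h2
    rw [h1, h2]
  initial_deriv := by
    filter_upwards [hu.initial_deriv, hv.initial_deriv] with x h1 h2
    rw [← h1, ← h2]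
    exact deriv_fun_sub ((contDiff_time hu.contDiff x).differentiable two_ne_zero _)
      ((contDiff_time hv.contDiff x).differentiable two_ne_zero _)

/-- Time reversal. -/
theorem IsSolution.reflect (hu : IsSolution u₀ u₁ u) :
    IsSolution u₀ (fun x => -u₁ x) fun t => u (-t) where
  contDiff := hu.contDiff.comp (contDiff_fst.neg.prodMk contDiff_snd)
  wave_eq t x := by
    have h1 := iteratedDeriv_comp_neg 2 (fun s => u s x) t
    rw [h1]
    simpa using hu.wave_eq (-t) x
  initial := by simpa using hu.initial
  initial_deriv := by
    filter_upwards [hu.initial_deriv] with x h1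
    rw [← h1]
    have := deriv_comp_neg (fun s => u s x) 0
    simpa using this

theorem IsSolution.congr (hu : IsSolution u₀ u₁ u) (h₀ : u₀ =ᵐ[volume] v₀)
    (h₁ : u₁ =ᵐ[volume] v₁) : IsSolution v₀ v₁ u :=
  ⟨hu.contDiff, hu.wave_eq, hu.initial.trans h₀, hu.initial_deriv.trans h₁⟩

theorem IsSolution.eq_zero_of_nonneg (hu : IsSolution (fun _ => 0) (fun _ => 0) u) {t : ℝ}
    (ht : 0 ≤ t) (x : EuclideanSpace ℝ (Fin d)) : u t x = 0 := by
  set U : ℝ × EuclideanSpace ℝ (Fin d) → ℂ := fun p => u p.1 p.2 with hUdef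
  have hU : ContDiff ℝ 2 U := hu.contDiff
  have hUd : Differentiable ℝ U := hU.differentiable two_ne_zero
  have hinit : ∀ x, U (0, x) = 0 := by
    have hc : Continuous fun x => U (0, x) := hU.continuous.comp (Continuous.prodMk_right 0)
    exact congrFun (hc.ae_eq_iff_eq volume continuous_const |>.1 hu.initial)
  have hinit' : ∀ x, fderiv ℝ U (0, x) (1, 0) = 0 := by
    have hc : Continuous fun x : EuclideanSpace ℝ (Fin d) => fderiv ℝ U (0, x) (1, 0) :=
      ((hU.continuous_fderiv two_ne_zero).comp (Continuous.prodMk_right 0)).clm_apply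
        continuous_const
    refine congrFun (hc.ae_eq_iff_eq volume continuous_const |>.1 ?_)
    filter_upwards [hu.initial_deriv] with x hx
    rw [← hx]
    exact (hasDerivAt_time (z := ((0 : ℝ), x)) (hUd _)).deriv.symm
  have key : ∀ ℓ : ℂ →L[ℝ] ℝ, ℓ (u t x) = 0 := by
    intro ℓ
    have hcomp : ∀ {f : ℝ × EuclideanSpace ℝ (Fin d) → ℂ}, Differentiable ℝ f → ∀ z a,
        fderiv ℝ (fun z => ℓ (f z)) z a = ℓ (fderiv ℝ f z a) := by
      intro f hf z a
      have : HasFDerivAt (fun z => ℓ (f z)) (ℓ.comp (fderiv ℝ f z)) z :=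
        ℓ.hasFDerivAt.comp z (hf z).hasFDerivAt
      rw [this.fderiv]
      rfl
    refine eq_zero_of_wave_of_nonneg (U := fun z => ℓ (U z)) (ℓ.contDiff.comp hU) ?_ ?_ ?_ ht x
    · intro z
      simp only [hcomp hUd, hcomp (differentiable_fderiv_apply hU _)]
      rw [hu.fderiv_eq z, map_sum]
    · intro y
      simp [hinit]
    · intro y
      simp [hcomp hUd, hinit']
  exact Complex.ext (key Complex.reCLM) (key Complex.imCLM)

theorem IsSolution.unique (hu : IsSolution u₀ u₁ u) (hv : IsSolution u₀ u₁ v) : u = v := by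
  have hw := hu.sub hv
  simp only [sub_self] at hw
  ext t x
  rw [← sub_eq_zero]
  rcases le_total 0 t with ht | ht
  · exact hw.eq_zero_of_nonneg ht x
  · have h := hw.reflect
    simp only [neg_zero] at h
    simpa using h.eq_zero_of_nonneg (neg_nonneg.2 ht) x

end Uniqueness

/-! ### The representation of the solution -/

section Representation

open Real Filter Topology Set
open scoped ContDiff RealInnerProductSpace

variable {d : ℕ} {r R : ℝ} {σ : ℝ} {w : ℝ → ℂ} {u u₀ u₁ : EuclideanSpace ℝ (Fin d) → ℂ}

theorem isSolution_halfWave (hr : 0 < r) (hσ : |σ| = 1) (hw : ContDiffOn ℝ ∞ w (Ioi 0))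
    (hu : Integrable u) (hsupp : tsupport (𝓕 u) ⊆ annulus d r R) :
    IsSolution (fun x => ∫ ξ, (𝐞 ⟪ξ, x⟫ : ℂ) * (w (‖ξ‖ ^ 2) * 𝓕 u ξ))
      (fun x => ∫ ξ, (𝐞 ⟪ξ, x⟫ : ℂ) *
        (2 * π * Complex.I * (σ * ‖ξ‖) * (w (‖ξ‖ ^ 2) * 𝓕 u ξ)))
      (halfWave σ w u) := by
  have hF := continuous_multiplier_mul_fourier hr hw.continuousOn hu hsupp
  have hFs : HasCompactSupport fun ξ => w (‖ξ‖ ^ 2) * 𝓕 u ξ :=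
    (hasCompactSupport_of_tsupport_subset_annulus hsupp).mul_left
  have hc : ContDiff ℝ 2 fun p : ℝ × EuclideanSpace ℝ (Fin d) => halfWave σ w u p.1 p.2 :=
    contDiff_coneWave hF hFs
  refine ⟨hc, fun t x => ?_, ?_, ?_⟩
  · rw [iteratedDeriv_two_time hc t x, laplacian_space hc t x]
    exact sub_eq_zero.2 (wave_coneWave hσ hF hFs (t, x))
  · refine Eventually.of_forall fun x => ?_
    simp [halfWave]
  · refine Eventually.of_forall fun x => ?_
    have h1 := (hasDerivAt_time (z := ((0 : ℝ), x)) (hc.differentiable two_ne_zero _)).deriv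
    have h2 := fderiv_coneWave (σ := σ) hF hFs ((0 : ℝ), x) (1, 0)
    refine h1.trans (h2.trans ?_)
    simp [coneWave]

/-- The multiplier `1/(4πi√a)` that turns `e^{2πit√a} - e^{-2πit√a}` into `sin(2πt√a)/(2π√a)`. -/
noncomputable def sineMultiplier (a : ℝ) : ℂ := (4 * π * Complex.I * √a)⁻¹

theorem contDiffOn_sineMultiplier : ContDiffOn ℝ ∞ sineMultiplier (Ioi 0) := by
  have h1 : ContDiffOn ℝ ∞ (fun a : ℝ => (√a : ℂ)) (Ioi 0) :=
    Complex.ofRealCLM.contDiff.comp_contDiffOn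
      (contDiffOn_id.sqrt fun a (ha : 0 < a) => ha.ne')
  refine (contDiffOn_const.mul h1).inv fun a ha => ?_
  have : (√a : ℂ) ≠ 0 := by exact_mod_cast (Real.sqrt_pos.2 ha).ne'
  have hπ : (π : ℂ) ≠ 0 := by exact_mod_cast pi_pos.ne'
  simp [this, hπ]

/-- The solution of the Cauchy problem: the multiplier `cos(2πt|ξ|)` on `u₀` and
`sin(2πt|ξ|)/(2π|ξ|)` on `u₁`, written with half-waves. -/
noncomputable def waveSolution (u₀ u₁ : EuclideanSpace ℝ (Fin d) → ℂ) (t : ℝ)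
    (x : EuclideanSpace ℝ (Fin d)) : ℂ :=
  halfWave 1 (fun _ => 1 / 2) u₀ t x + halfWave (-1) (fun _ => 1 / 2) u₀ t x +
    (halfWave 1 sineMultiplier u₁ t x - halfWave (-1) sineMultiplier u₁ t x)

theorem isSolution_waveSolution (hr : 0 < r) (hu₀ : Integrable u₀) (hu₁ : Integrable u₁)
    (hs₀ : tsupport (𝓕 u₀) ⊆ annulus d r R) (hs₁ : tsupport (𝓕 u₁) ⊆ annulus d r R) :
    IsSolution u₀ u₁ (waveSolution u₀ u₁) := by
  have hw : ContDiffOn ℝ ∞ (fun _ : ℝ => (1 / 2 : ℂ)) (Ioi 0) := contDiffOn_const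
  have a1 : |(1 : ℝ)| = 1 := abs_one
  have a2 : |(-1 : ℝ)| = 1 := by simp
  have h := ((isSolution_halfWave hr a1 hw hu₀ hs₀).add
    (isSolution_halfWave hr a2 hw hu₀ hs₀)).add
    ((isSolution_halfWave hr a1 contDiffOn_sineMultiplier hu₁ hs₁).sub
    (isSolution_halfWave hr a2 contDiffOn_sineMultiplier hu₁ hs₁))
  have hF₀ := integrable_fourier_of_tsupport_subset_annulus hu₀ hs₀
  have hF₁ := integrable_fourier_of_tsupport_subset_annulus hu₁ hs₁
  have hinv : ∀ {u : EuclideanSpace ℝ (Fin d) → ℂ} (x : EuclideanSpace ℝ (Fin d)),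
      𝓕⁻ (𝓕 u) x = ∫ ξ, (𝐞 ⟪ξ, x⟫ : ℂ) * 𝓕 u ξ := fun x => by
    rw [Real.fourierInv_eq]; rfl
  refine h.congr ?_ ?_
  · refine EventuallyEq.trans (Eventually.of_forall fun x => ?_) (fourierInv_fourier_ae_eq hu₀ hF₀)
    -- the two sine terms cancel at time `0`
    simp only [hinv, sub_self, add_zero]
    simp only [mul_left_comm _ (1 / 2 : ℂ) _, integral_const_mul]
    ring
  · refine EventuallyEq.trans (Eventually.of_forall fun x => ?_) (fourierInv_fourier_ae_eq hu₁ hF₁)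
    simp only [hinv]
    have e0 : ∀ (w : ℝ → ℂ) (u : EuclideanSpace ℝ (Fin d) → ℂ),
        ∫ ξ, (𝐞 ⟪ξ, x⟫ : ℂ) * (2 * π * Complex.I * (((-1 : ℝ) : ℂ) * ‖ξ‖) * (w (‖ξ‖ ^ 2) * 𝓕 u ξ)) =
        -∫ ξ, (𝐞 ⟪ξ, x⟫ : ℂ) *
          (2 * π * Complex.I * (((1 : ℝ) : ℂ) * ‖ξ‖) * (w (‖ξ‖ ^ 2) * 𝓕 u ξ)) := by
      intro w u
      rw [← integral_neg]
      refine integral_congr_ae (Eventually.of_forall fun ξ => ?_)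
      simp only
      push_cast
      ring
    have e1 := e0 (fun _ => 1 / 2) u₀
    rw [e1, e0 sineMultiplier u₁, add_neg_cancel, zero_add, sub_neg_eq_add, ← two_mul,
      ← integral_const_mul]
    refine integral_congr_ae (Eventually.of_forall fun ξ => ?_)
    simp only
    by_cases hξ : 𝓕 u₁ ξ = 0
    · simp [hξ]
    · have hpos : 0 < ‖ξ‖ := hr.trans_le (hs₁ (subset_tsupport _ hξ)).1
      have hne : (‖ξ‖ : ℂ) ≠ 0 := by exact_mod_cast hpos.ne'
      have hπ : (π : ℂ) ≠ 0 := by exact_mod_cast pi_pos.ne'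
      have hI := Complex.I_ne_zero
      simp only [sineMultiplier, Real.sqrt_sq hpos.le, Complex.ofReal_one, one_mul]
      field_simp
      ring

end Representation

end FreeWave

theorem mainTheorem6 (d : ℕ) (hd : 1 ≤ d) (r R : ℝ) (hr : 0 < r) (hrR : r < R) :
    ∃ C : ℝ, 0 < C ∧
      ∀ (h : ℝ) (u₀ u₁ : EuclideanSpace ℝ (Fin d) → ℂ),
        Integrable u₀ volume → Integrable u₁ volume →
        tsupport (𝓕 u₀) ⊆ FreeWave.annulus d r R →
        tsupport (𝓕 u₁) ⊆ FreeWave.annulus d r R →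
        max (Metric.diam (tsupport (𝓕 u₀))) (Metric.diam (tsupport (𝓕 u₁))) ≤ h →
        (∃! u : ℝ → EuclideanSpace ℝ (Fin d) → ℂ, FreeWave.IsSolution u₀ u₁ u) ∧
        ∀ u : ℝ → EuclideanSpace ℝ (Fin d) → ℂ, FreeWave.IsSolution u₀ u₁ u →
          ∀ d' : ℝ, 0 ≤ d' → d' ≤ (d : ℝ) - 1 → ∀ t : ℝ, 0 < t →
            eLpNorm (u t) ⊤ volume ≤
              ENNReal.ofReal (C * h ^ ((d : ℝ) - d') / t ^ (d' / 2)) *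
                (eLpNorm u₀ 1 volume + eLpNorm u₁ 1 volume) := by
  have hw : ContDiffOn ℝ (↑(⊤ : ℕ∞)) (fun _ : ℝ => (1 / 2 : ℂ)) (Set.Ioi 0) := contDiffOn_const
  have a1 : |(1 : ℝ)| = 1 := abs_one
  have a2 : |(-1 : ℝ)| = 1 := by simp
  obtain ⟨C₁, hC₁, hB₁⟩ := FreeWave.exists_norm_halfWave_le (R := R) hd hr a1 hw
  obtain ⟨C₂, hC₂, hB₂⟩ := FreeWave.exists_norm_halfWave_le (R := R) hd hr a2 hw
  obtain ⟨C₃, hC₃, hB₃⟩ := FreeWave.exists_norm_halfWave_le (R := R) hd hr a1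
    FreeWave.contDiffOn_sineMultiplier
  obtain ⟨C₄, hC₄, hB₄⟩ := FreeWave.exists_norm_halfWave_le (R := R) hd hr a2
    FreeWave.contDiffOn_sineMultiplier
  -- the summand `1` only makes the constant positive
  refine ⟨C₁ + C₂ + C₃ + C₄ + 1, by positivity, ?_⟩
  intro h u₀ u₁ hu₀ hu₁ hs₀ hs₁ hdiam
  have hsol := FreeWave.isSolution_waveSolution hr hu₀ hu₁ hs₀ hs₁
  refine ⟨⟨_, hsol, fun v hv => hv.unique hsol⟩, ?_⟩
  intro u hu d' hd'0 hd'1 t ht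
  rw [hu.unique hsol]
  have hh₀ := (le_max_left _ _).trans hdiam
  have hh₁ := (le_max_right _ _).trans hdiam
  have hh : 0 ≤ h := Metric.diam_nonneg.trans hh₀
  have hn₀ : 0 ≤ ∫ y, ‖u₀ y‖ := integral_nonneg fun _ => norm_nonneg _
  have hn₁ : 0 ≤ ∫ y, ‖u₁ y‖ := integral_nonneg fun _ => norm_nonneg _
  set D := h ^ ((d : ℝ) - d') / t ^ (d' / 2) with hD
  have hD0 : 0 ≤ D := by positivity
  have hpt : ∀ x, ‖FreeWave.waveSolution u₀ u₁ t x‖ ≤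
      (C₁ + C₂ + C₃ + C₄ + 1) * h ^ ((d : ℝ) - d') / t ^ (d' / 2) *
        ((∫ y, ‖u₀ y‖) + ∫ y, ‖u₁ y‖) := by
    intro x
    have b₁ := hB₁ u₀ hu₀ hs₀ h hh₀ d' hd'0 hd'1 t ht x
    have b₂ := hB₂ u₀ hu₀ hs₀ h hh₀ d' hd'0 hd'1 t ht x
    have b₃ := hB₃ u₁ hu₁ hs₁ h hh₁ d' hd'0 hd'1 t ht x
    have b₄ := hB₄ u₁ hu₁ hs₁ h hh₁ d' hd'0 hd'1 t ht x
    rw [mul_div_assoc, ← hD] at b₁ b₂ b₃ b₄ ⊢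
    calc ‖FreeWave.waveSolution u₀ u₁ t x‖ ≤ (C₁ * D * ∫ y, ‖u₀ y‖) + (C₂ * D * ∫ y, ‖u₀ y‖) +
          ((C₃ * D * ∫ y, ‖u₁ y‖) + (C₄ * D * ∫ y, ‖u₁ y‖)) :=
          (norm_add_le _ _).trans (add_le_add ((norm_add_le _ _).trans (add_le_add b₁ b₂))
            ((norm_sub_le _ _).trans (add_le_add b₃ b₄)))
      _ = (C₁ + C₂) * D * (∫ y, ‖u₀ y‖) + (C₃ + C₄) * D * ∫ y, ‖u₁ y‖ := by ring
      _ ≤ (C₁ + C₂ + C₃ + C₄ + 1) * D * (∫ y, ‖u₀ y‖) +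
          (C₁ + C₂ + C₃ + C₄ + 1) * D * ∫ y, ‖u₁ y‖ := by
          have l₁ : C₁ + C₂ ≤ C₁ + C₂ + C₃ + C₄ + 1 := by linarith
          have l₂ : C₃ + C₄ ≤ C₁ + C₂ + C₃ + C₄ + 1 := by linarith
          gcongr
      _ = _ := by ring
  have hL : ∀ {f : EuclideanSpace ℝ (Fin d) → ℂ}, Integrable f →
      eLpNorm f 1 volume = ENNReal.ofReal (∫ y, ‖f y‖) := fun hf => by
    rw [eLpNorm_one_eq_lintegral_enorm, ofReal_integral_norm_eq_lintegral_enorm hf]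
  rw [hL hu₀, hL hu₁, ← ENNReal.ofReal_add hn₀ hn₁, ← ENNReal.ofReal_mul (by positivity),
    eLpNorm_exponent_top]
  exact eLpNormEssSup_le_of_ae_bound (Filter.Eventually.of_forall hpt)
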